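/- Let $\mathcal C$ be a symmetric monoidal category with tensor $\otimes$, unit $I$ and structural isomorphisms $\alpha,\lambda,\rho,s$. **Lenses.** For pairs $\Phi=(X,S)$, $\Psi=(Y,R)$ of objects of $\mathcal C$ let $$\mathrm{Lens}_{\mathcal C}(\Phi,\Psi)=\int^{A:\mathcal C}\mathcal C(X,A\otimes Y)\times\mathcal C(A\otimes R,S),$$ that is, the triples $[A,v,u]$ with $v:X\to A\otimes Y$ and $u:A\otimes R\to S$, modulo the equivalence relation generated by $[B,(f\otimes \mathrm{id}_Y)\circ v,u]\sim[A,v,u\circ(f\otimes\mathrm{id}_R)]$ for $f:A\to B$. (It is assumed that these coends exist; forming them in a sufficiently large universe of sets makes this automatic.) For $f:X\to Y$ and $g:R\to S$ write $[f,g]=[I,\lambda_Y^{-1}\circ f,\,g\circ\lambda_R]$. With composition $[A',v',u']\circ[A,v,u]=[A\otimes A',(\mathrm{id}_A\otimes v')\circ v,\,u\circ(\mathrm{id}_A\otimes u')]$, tensor $(X,S)\otimes(X',S')=(X\otimes X',S\otimes S')$, $[A,v,u]\otimes[A',v',u']=[A\otimes A',(\mathrm{id}\otimes s\otimes\mathrm{id})\circ(v\otimes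 v'),(u\otimes u')\circ(\mathrm{id}\otimes s\otimes\mathrm{id})]$ (associators suppressed), unit $(I,I)$ and structural isomorphisms $[\alpha,\alpha^{-1}]$, $[\lambda,\lambda^{-1}]$, $[\rho,\rho^{-1}]$, $[s,s^{-1}]$, $\mathrm{Lens}_{\mathcal C}$ is a symmetric monoidal category, so the construction can be iterated. **Contexts.** A context for $(\Phi,\Psi)$ is a state of the double lens category, $$\mathbb C(\Phi,\Psi)=\mathrm{Lens}_{\mathrm{Lens}_{\mathcal C}}\big(I,(\Phi,\Psi)\big)=\int^{\Theta:\mathrm{Lens}_{\mathcal C}}\mathrm{Lens}_{\mathcal C}(I,\Theta\otimes\Phi)\times\mathrm{Lens}_{\mathcal C}(\Theta\otimes\Psi,I).$$ For $[p,k]$ with bound object $\Theta$ and lenses $l,m$, $[l\circ p,k\circ m]$ means $[(\mathrm{id}_\Theta\otimes l)\circ p,\;k\circ(\mathrm{id}_\Theta\otimes m)]$. For $[p,k]\in\mathbb C(\Phi\otimes\Phi',\Psi\otimes\Psi')$ the left local context $\mathcal L([p,k],l')\in\mathbb C(\Phi,\Psi)$, $l':\Phi'\to\Psi'$, has bound object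 $\Theta\otimes\Psi'$: it applies $l'$ to the $\Phi'$-output of $p$ and passes the resulting $\Psi'$ to $k$, leaving a hole from $\Phi$ to $\Psi$. The right local context $\mathcal R([p,k],l)\in\mathbb C(\Phi',\Psi')$, $l:\Phi\to\Psi$, with bound object $\Theta\otimes\Psi$, is defined symmetrically. **Open games.** An open game $\mathcal G:\Phi\to\Psi$ consists of a set $\Sigma_{\mathcal G}$, a function $P_{\mathcal G}:\Sigma_{\mathcal G}\to\mathrm{Lens}_{\mathcal C}(\Phi,\Psi)$, and a function $B_{\mathcal G}$ assigning to each context in $\mathbb C(\Phi,\Psi)$ a relation on $\Sigma_{\mathcal G}$, where $B_{\mathcal G}(c)(\sigma)\subseteq\Sigma_{\mathcal G}$ denotes the set of strategies to which $\sigma$ is related. Composition and tensor have strategy set $\Sigma_{\mathcal G}\times\Sigma_{\mathcal H}$, play functions $P_{\mathcal H}(\tau)\circ P_{\mathcal G}(\sigma)$ and $P_{\mathcal G}(\sigma)\otimes P_{\mathcal H}(\tau)$, and $$B_{\mathcal H\circ\mathcal G}[p,k](\sigma,\tau)=B_{\mathcal G}[p,k\circ P_{\mathcal H}(\tau)](\sigma)\times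 B_{\mathcal H}[P_{\mathcal G}(\sigma)\circ p,k](\tau),$$ $$B_{\mathcal G\otimes\mathcal H}(c)(\sigma,\tau)=B_{\mathcal G}(\mathcal L(c,P_{\mathcal H}(\tau)))(\sigma)\times B_{\mathcal H}(\mathcal R(c,P_{\mathcal G}(\sigma)))(\tau).$$ A lens $l$ gives the open game whose only strategy is $l$, played as $l$ and related to itself in every context; the one given by $[f,g]$ is written $\langle f,g\rangle$. A simulation $\mathcal G\to\mathcal H$ of open games $\Phi\to\Psi$ is a relation $\beta\subseteq\Sigma_{\mathcal G}\times\Sigma_{\mathcal H}$ that relates each $\sigma\in\Sigma_{\mathcal G}$ to some $\tau\in\Sigma_{\mathcal H}$ and is such that $\beta(\sigma,\tau)$ implies $P_{\mathcal G}(\sigma)=P_{\mathcal H}(\tau)$ and, for all contexts $c$ and all $\sigma'\in B_{\mathcal G}(c)(\sigma)$, there is $\tau'\in B_{\mathcal H}(c)(\tau)$ with $\beta(\sigma',\tau')$. Two games are equivalent (bisimilar) if some simulation between them has a converse that is also a simulation. **Theorem.** The pairs of objects of $\mathcal C$, with the equivalence classes of open games as morphisms, form a symmetric monoidal category $\mathrm{Game}_{\mathcal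 C}$. Composition and the tensor of morphisms are induced by those of open games, the identities are the classes of the games given by identity lenses, the tensor of objects and the unit are as in $\mathrm{Lens}_{\mathcal C}$, and the associator, unitors and symmetry are the classes of $\langle\alpha,\alpha^{-1}\rangle$, $\langle\lambda,\lambda^{-1}\rangle$, $\langle\rho,\rho^{-1}\rangle$ and, at $(X,A),(Y,B)$, $\langle s_{X,Y},s_{B,A}\rangle$. In particular $\otimes$ is a functor $\mathrm{Game}_{\mathcal C}\times\mathrm{Game}_{\mathcal C}\to\mathrm{Game}_{\mathcal C}$ and these structural isomorphisms are natural. -/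

import Mathlib

open CategoryTheory MonoidalCategory

universe w v u

/-- Objects of the category of lenses over `C`: pairs of objects of `C`. -/
structure LensCat (C : Type u) where
  fst : C
  snd : C

section Interchange

variable {C : Type u} [Category.{v} C] [MonoidalCategory C]

theorem comp_tensorHom_left {X Y Z X' Y' : C} (f : X ⟶ Y) (g : Y ⟶ Z) (h : X' ⟶ Y') :
    ((f ≫ g) ⊗ₘ h) = (f ⊗ₘ h) ≫ g ▷ Y' := by
  rw [← tensorHom_id, tensorHom_comp_tensorHom, Category.comp_id]

theorem comp_tensorHom_right {X Y Z X' Y' : C} (f : X ⟶ Y) (g : Y ⟶ Z) (h : X' ⟶ Y') :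
    (h ⊗ₘ (f ≫ g)) = (h ⊗ₘ f) ≫ Y' ◁ g := by
  rw [← id_tensorHom, tensorHom_comp_tensorHom, Category.comp_id]

theorem comp_tensorHom_left' {X Y Z X' Y' : C} (f : X ⟶ Y) (g : Y ⟶ Z) (h : X' ⟶ Y') :
    ((f ≫ g) ⊗ₘ h) = f ▷ X' ≫ (g ⊗ₘ h) := by
  rw [← tensorHom_id, tensorHom_comp_tensorHom, Category.id_comp]

theorem comp_tensorHom_right' {X Y Z X' Y' : C} (f : X ⟶ Y) (g : Y ⟶ Z) (h : X' ⟶ Y') :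
    (h ⊗ₘ (f ≫ g)) = X' ◁ f ≫ (h ⊗ₘ g) := by
  rw [← id_tensorHom, tensorHom_comp_tensorHom, Category.id_comp]

variable [SymmetricCategory C]

theorem tensorμ_slide {A B A' B' : C} (f : A ⟶ B) (f' : A' ⟶ B') (Y Y' : C) :
    tensorμ A Y A' Y' ≫ (f ⊗ₘ f') ▷ (Y ⊗ Y') = (f ▷ Y ⊗ₘ f' ▷ Y') ≫ tensorμ B Y B' Y' := by
  have := tensorμ_natural f (𝟙 Y) f' (𝟙 Y')
  simpa using this.symm

theorem tensorμ_slide_right (A A' : C) {Y Z Y' Z' : C} (f : Y ⟶ Z) (f' : Y' ⟶ Z') :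
    tensorμ A Y A' Y' ≫ (A ⊗ A') ◁ (f ⊗ₘ f') = (A ◁ f ⊗ₘ A' ◁ f') ≫ tensorμ A Z A' Z' := by
  have := tensorμ_natural (𝟙 A) f (𝟙 A') f'
  simpa using this.symm

theorem tensorμ_self (A B A' B' : C) : tensorμ A B A' B' ≫ tensorμ A A' B B' = 𝟙 _ := by
  have : tensorμ A A' B B' = tensorδ A B A' B' := by
    simp [tensorμ, tensorδ, SymmetricCategory.braiding_swap_eq_inv_braiding B A']
  rw [this, tensorμ_tensorδ]

theorem tensorμ_self_assoc (A B A' B' : C) {Z : C} (h : (A ⊗ B) ⊗ A' ⊗ B' ⟶ Z) :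
    tensorμ A B A' B' ≫ tensorμ A A' B B' ≫ h = h := by
  rw [← Category.assoc, tensorμ_self, Category.id_comp]

theorem tensorμ_braiding_view (A Y A' Y' : C) :
    tensorμ A Y A' Y' ≫ ((β_ A A').hom ⊗ₘ (β_ Y Y').hom) =
      (β_ (A ⊗ Y) (A' ⊗ Y')).hom ≫ tensorμ A' Y' A Y := by
  simp [tensorμ, SymmetricCategory.braiding_swap_eq_inv_braiding A Y',
    MonoidalCategory.tensorHom_def]

theorem tensorμ_braiding_update (A A' R R' : C) :
    tensorμ A A' R R' ≫ (β_ (A ⊗ R) (A' ⊗ R')).hom =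
      ((β_ A A').hom ⊗ₘ (β_ R R').hom) ≫ tensorμ A' A R' R := by
  simp [tensorμ, SymmetricCategory.braiding_swap_eq_inv_braiding A' R,
    MonoidalCategory.tensorHom_def]

end Interchange

section LensHom

variable {C : Type u} [Category.{v} C] [MonoidalCategory C]

/-- Triples `(A, v, u)`, representing the elements of the disjoint union over `A` of
`C(X, A ⊗ Y) × C(A ⊗ R, S)`, for `P = (X, S)` and `Q = (Y, R)`. -/
structure PreLens (P Q : LensCat C) where
  bound : C
  view : P.fst ⟶ bound ⊗ Q.fst
  update : bound ⊗ Q.snd ⟶ P.snd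

/-- The generating relation `((f ⊗ id_Y) ∘ v, u) ~ (v, u ∘ (f ⊗ id_R))` for `f : A ⟶ B`. -/
inductive PreLens.Slide {P Q : LensCat C} : PreLens P Q → PreLens P Q → Prop
  | slide {A B : C} (f : A ⟶ B) (v : P.fst ⟶ A ⊗ Q.fst) (u : B ⊗ Q.snd ⟶ P.snd) :
      PreLens.Slide ⟨B, v ≫ f ▷ Q.fst, u⟩ ⟨A, v, f ▷ Q.snd ≫ u⟩

/-- Coend lenses `P ⟶ Q`: the coend `∫^A C(X, A ⊗ Y) × C(A ⊗ R, S)`, as the quotient of the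
triples by the equivalence relation generated by sliding. -/
def LensHom (P Q : LensCat C) : Type (max u v) :=
  Quot (PreLens.Slide (P := P) (Q := Q))

namespace LensHom

/-- The class `[A, v, u]`. -/
def mk {P Q : LensCat C} (A : C) (v : P.fst ⟶ A ⊗ Q.fst) (u : A ⊗ Q.snd ⟶ P.snd) :
    LensHom P Q :=
  Quot.mk _ ⟨A, v, u⟩

theorem slide {P Q : LensCat C} {A B : C} (f : A ⟶ B) (v : P.fst ⟶ A ⊗ Q.fst)
    (u : B ⊗ Q.snd ⟶ P.snd) : mk B (v ≫ f ▷ Q.fst) u = mk A v (f ▷ Q.snd ≫ u) :=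
  Quot.sound (PreLens.Slide.slide f v u)

theorem ind {P Q : LensCat C} {p : LensHom P Q → Prop}
    (h : ∀ (A : C) (v : P.fst ⟶ A ⊗ Q.fst) (u : A ⊗ Q.snd ⟶ P.snd), p (mk A v u)) (l) : p l :=
  Quot.ind (fun x => h x.bound x.view x.update) l

/-- Lenses out of `P` into `Q` are the couniversal co-wedge on `C(X, A ⊗ Y) × C(A ⊗ R, S)`. -/
theorem existsUnique_desc {P Q : LensCat C} {T : Type w}
    (d : ∀ A : C, (P.fst ⟶ A ⊗ Q.fst) × (A ⊗ Q.snd ⟶ P.snd) → T)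
    (hd : ∀ {A B : C} (f : A ⟶ B) (v : P.fst ⟶ A ⊗ Q.fst) (u : B ⊗ Q.snd ⟶ P.snd),
      d B (v ≫ f ▷ Q.fst, u) = d A (v, f ▷ Q.snd ≫ u)) :
    ∃! h : LensHom P Q → T, ∀ A v u, h (mk A v u) = d A (v, u) := by
  refine ⟨Quot.lift (fun x => d x.bound (x.view, x.update)) ?_, fun _ _ _ => rfl, ?_⟩
  · rintro _ _ ⟨f, v, u⟩
    exact hd f v u
  · intro h hh
    funext l
    induction l using ind with
    | h A v u => exact hh A v u

theorem sound {P Q : LensCat C} {A B : C} (f : A ⟶ B) {v : P.fst ⟶ A ⊗ Q.fst}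
    {u : A ⊗ Q.snd ⟶ P.snd} {v' : P.fst ⟶ B ⊗ Q.fst} {u' : B ⊗ Q.snd ⟶ P.snd}
    (hv : v ≫ f ▷ Q.fst = v') (hu : u = f ▷ Q.snd ≫ u') : mk A v u = mk B v' u' := by
  subst hv hu
  exact (slide f v u').symm

/-- The lens `[I, f, g] : (X, S) ⟶ (Y, R)` of a pair `f : X ⟶ Y`, `g : R ⟶ S`. -/
def ofPair {P Q : LensCat C} (f : P.fst ⟶ Q.fst) (g : Q.snd ⟶ P.snd) : LensHom P Q :=
  mk (𝟙_ C) (f ≫ (λ_ Q.fst).inv) ((λ_ Q.snd).hom ≫ g)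

/-- Sequential composition (in diagrammatic order):
`[A', v', u'] ∘ [A, v, u] = [A ⊗ A', (id_A ⊗ v') ∘ v, u ∘ (id_A ⊗ u')]`. -/
def comp {P Q R : LensCat C} : LensHom P Q → LensHom Q R → LensHom P R :=
  Quot.lift₂
    (fun l m => mk (l.bound ⊗ m.bound)
      (l.view ≫ l.bound ◁ m.view ≫ (α_ _ _ _).inv)
      ((α_ _ _ _).hom ≫ l.bound ◁ m.update ≫ l.update))
    (by
      rintro l _ _ ⟨f, v, u⟩
      refine (sound (l.bound ◁ f) ?_ ?_).symm <;> simp)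
    (by
      rintro _ _ m ⟨f, v, u⟩
      refine (sound (f ▷ m.bound) ?_ ?_).symm
      · simp [← whisker_exchange_assoc]
      · simp [whisker_exchange_assoc])

theorem mk_comp_mk {P Q R : LensCat C} (A : C) (v : P.fst ⟶ A ⊗ Q.fst) (u : A ⊗ Q.snd ⟶ P.snd)
    (B : C) (v' : Q.fst ⟶ B ⊗ R.fst) (u' : B ⊗ R.snd ⟶ Q.snd) :
    comp (mk A v u) (mk B v' u') =
      mk (A ⊗ B) (v ≫ A ◁ v' ≫ (α_ _ _ _).inv) ((α_ _ _ _).hom ≫ A ◁ u' ≫ u) := rfl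

theorem ofPair_comp_mk {P Q R : LensCat C} (f : P.fst ⟶ Q.fst) (g : Q.snd ⟶ P.snd)
    (A : C) (v : Q.fst ⟶ A ⊗ R.fst) (u : A ⊗ R.snd ⟶ Q.snd) :
    comp (ofPair f g) (mk A v u) = mk A (f ≫ v) (u ≫ g) := by
  refine sound (λ_ A).hom ?_ ?_ <;> simp

theorem mk_comp_ofPair {P Q R : LensCat C} (A : C) (v : P.fst ⟶ A ⊗ Q.fst)
    (u : A ⊗ Q.snd ⟶ P.snd) (f : Q.fst ⟶ R.fst) (g : R.snd ⟶ Q.snd) :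
    comp (mk A v u) (ofPair f g) = mk A (v ≫ A ◁ f) (A ◁ g ≫ u) := by
  refine sound (ρ_ A).hom ?_ ?_ <;> simp

theorem ofPair_comp_ofPair {P Q R : LensCat C} (f : P.fst ⟶ Q.fst) (g : Q.snd ⟶ P.snd)
    (f' : Q.fst ⟶ R.fst) (g' : R.snd ⟶ Q.snd) :
    comp (ofPair f g) (ofPair f' g') = ofPair (f ≫ f') (g' ≫ g) := by
  refine (ofPair_comp_mk _ _ _ _ _).trans ?_
  simp [ofPair]

/-- The tensor of lenses:
`[A, v, u] ⊗ [A', v', u'] = [A ⊗ A', (id ⊗ s ⊗ id) ∘ (v ⊗ v'), (u ⊗ u') ∘ (id ⊗ s ⊗ id)]`,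
where `tensorμ` is the middle-four interchange `id ⊗ s ⊗ id`. -/
def tensor [SymmetricCategory C] {P Q P' Q' : LensCat C} :
    LensHom P Q → LensHom P' Q' →
      LensHom (C := C) ⟨P.fst ⊗ P'.fst, P.snd ⊗ P'.snd⟩ ⟨Q.fst ⊗ Q'.fst, Q.snd ⊗ Q'.snd⟩ :=
  Quot.lift₂
    (fun l m => mk (l.bound ⊗ m.bound)
      ((l.view ⊗ₘ m.view) ≫ tensorμ _ _ _ _)
      (tensorμ _ _ _ _ ≫ (l.update ⊗ₘ m.update)))
    (by
      rintro l _ _ ⟨f, v, u⟩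
      refine (sound (𝟙 l.bound ⊗ₘ f) ?_ ?_).symm
      · dsimp only
        rw [Category.assoc, tensorμ_slide, tensorHom_comp_tensorHom_assoc]
        simp
      · dsimp only
        rw [tensorμ_natural_left_assoc, tensorHom_comp_tensorHom]
        simp)
    (by
      rintro _ _ m ⟨f, v, u⟩
      refine (sound (f ⊗ₘ 𝟙 m.bound) ?_ ?_).symm
      · dsimp only
        rw [Category.assoc, tensorμ_slide, tensorHom_comp_tensorHom_assoc]
        simp
      · dsimp only
        rw [tensorμ_natural_left_assoc, tensorHom_comp_tensorHom]
        simp)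

theorem mk_tensor_mk [SymmetricCategory C] {P Q P' Q' : LensCat C}
    (A : C) (v : P.fst ⟶ A ⊗ Q.fst) (u : A ⊗ Q.snd ⟶ P.snd)
    (B : C) (v' : P'.fst ⟶ B ⊗ Q'.fst) (u' : B ⊗ Q'.snd ⟶ P'.snd) :
    tensor (mk A v u) (mk B v' u') =
      mk (A ⊗ B) ((v ⊗ₘ v') ≫ tensorμ _ _ _ _) (tensorμ _ _ _ _ ≫ (u ⊗ₘ u')) := rfl

theorem ofPair_tensor_ofPair [SymmetricCategory C] {P Q P' Q' : LensCat C}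
    (f : P.fst ⟶ Q.fst) (g : Q.snd ⟶ P.snd) (f' : P'.fst ⟶ Q'.fst) (g' : Q'.snd ⟶ P'.snd) :
    tensor (ofPair f g) (ofPair f' g') =
      ofPair (P := ⟨P.fst ⊗ P'.fst, P.snd ⊗ P'.snd⟩) (Q := ⟨Q.fst ⊗ Q'.fst, Q.snd ⊗ Q'.snd⟩)
        (f ⊗ₘ f') (g ⊗ₘ g') := by
  refine sound (λ_ (𝟙_ C)).hom ?_ ?_
  · dsimp only
    rw [← tensorHom_comp_tensorHom]
    simp only [Category.assoc]
    congr 1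
    rw [← cancel_mono (λ_ _).hom]
    simp only [Category.assoc, Iso.inv_hom_id, ← leftUnitor_monoidal]
    simp
  · dsimp only
    rw [← tensorHom_comp_tensorHom, leftUnitor_monoidal]
    simp [tensorμ_self_assoc]

theorem ofPair_eta {P Q : LensCat C} (A : C) (v : P.fst ⟶ A ⊗ Q.fst) (u : A ⊗ Q.snd ⟶ P.snd) :
    comp (ofPair (𝟙 _) (𝟙 _)) (mk A v u) = mk A v u := by
  simp [ofPair_comp_mk]

end LensHom

open LensHom

instance LensCat.category : Category (LensCat C) where
  Hom P Q := LensHom P Q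
  id P := ofPair (𝟙 P.fst) (𝟙 P.snd)
  comp l m := LensHom.comp l m
  id_comp l := by
    induction l using LensHom.ind with
    | h A v u => rw [ofPair_comp_mk]; simp
  comp_id l := by
    induction l using LensHom.ind with
    | h A v u => rw [mk_comp_ofPair]; simp
  assoc l m n := by
    induction l using LensHom.ind with
    | h A v u =>
      induction m using LensHom.ind with
      | h A' v' u' =>
        induction n using LensHom.ind with
        | h A'' v'' u'' =>
          simp only [mk_comp_mk]
          refine sound (α_ A A' A'').hom ?_ ?_ <;> simp

/-- An isomorphism of lenses from a pair of isomorphisms in `C`. -/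
def LensCat.isoOfPair {P Q : LensCat C} (e : P.fst ≅ Q.fst) (e' : P.snd ≅ Q.snd) : P ≅ Q where
  hom := ofPair e.hom e'.inv
  inv := ofPair e.inv e'.hom
  hom_inv_id := (ofPair_comp_ofPair _ _ _ _).trans (by rw [e.hom_inv_id, e'.hom_inv_id]; rfl)
  inv_hom_id := (ofPair_comp_ofPair _ _ _ _).trans (by rw [e.inv_hom_id, e'.inv_hom_id]; rfl)

variable [SymmetricCategory C]

instance LensCat.monoidalCategoryStruct : MonoidalCategoryStruct (LensCat C) where
  tensorObj P Q := ⟨P.fst ⊗ Q.fst, P.snd ⊗ Q.snd⟩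
  tensorHom l m := LensHom.tensor l m
  whiskerLeft P _ _ m := LensHom.tensor (𝟙 P : P ⟶ P) m
  whiskerRight l P := LensHom.tensor l (𝟙 P : P ⟶ P)
  tensorUnit := ⟨𝟙_ C, 𝟙_ C⟩
  associator P Q R := LensCat.isoOfPair (α_ P.fst Q.fst R.fst) (α_ P.snd Q.snd R.snd)
  leftUnitor P := LensCat.isoOfPair (λ_ P.fst) (λ_ P.snd)
  rightUnitor P := LensCat.isoOfPair (ρ_ P.fst) (ρ_ P.snd)

theorem LensHom.tensor_comp_tensor {P Q R P' Q' R' : LensCat C} (l : LensHom P Q)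
    (l' : LensHom P' Q') (m : LensHom Q R) (m' : LensHom Q' R') :
    (l.tensor l').comp (m.tensor m') = (l.comp m).tensor (l'.comp m') := by
  induction l using LensHom.ind with | h A v u =>
  induction l' using LensHom.ind with | h A' v' u' =>
  induction m using LensHom.ind with | h B w x =>
  induction m' using LensHom.ind with | h B' w' x' =>
  refine sound (tensorμ A A' B B') ?_ ?_
  · have h := associator_monoidal A B R.fst A' B' R'.fst
    have h' : tensorμ A (B ⊗ R.fst) A' (B' ⊗ R'.fst) ≫ (A ⊗ A') ◁ tensorμ B R.fst B' R'.fst ≫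
        (α_ _ _ _).inv ≫ tensorμ A A' B B' ▷ (R.fst ⊗ R'.fst) =
        ((α_ A B R.fst).inv ⊗ₘ (α_ A' B' R'.fst).inv) ≫
          tensorμ (A ⊗ B) R.fst (A' ⊗ B') R'.fst := by
      have h1 := congrArg (fun k => ((α_ A B R.fst).inv ⊗ₘ (α_ A' B' R'.fst).inv) ≫ k ≫
        (α_ _ _ _).inv ≫ tensorμ A A' B B' ▷ (R.fst ⊗ R'.fst)) h
      simp only [Category.assoc, Iso.hom_inv_id_assoc, tensorHom_comp_tensorHom_assoc,
        Iso.inv_hom_id, ← comp_whiskerRight, tensorμ_self, id_whiskerRight, Category.comp_id,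
        id_tensorHom_id, Category.id_comp] at h1
      exact h1.symm
    dsimp only
    simp only [Category.assoc, whiskerLeft_comp]
    rw [← Category.assoc (tensorμ A Q.fst A' Q'.fst), tensorμ_slide_right]
    simp only [Category.assoc, h', tensorHom_comp_tensorHom_assoc]
  · dsimp only
    simp only [Category.assoc, whiskerLeft_comp, tensorμ_natural_right_assoc]
    rw [← tensor_associativity_assoc]
    simp only [tensorHom_comp_tensorHom]

theorem LensHom.tensor_associator {P Q P' Q' P'' Q'' : LensCat C} (l : LensHom P Q)
    (l' : LensHom P' Q') (l'' : LensHom P'' Q'') :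
    ((l.tensor l').tensor l'').comp (ofPair (α_ _ _ _).hom (α_ _ _ _).inv) =
      (ofPair (α_ _ _ _).hom (α_ _ _ _).inv).comp (l.tensor (l'.tensor l'')) := by
  induction l using LensHom.ind with | h A v u =>
  induction l' using LensHom.ind with | h A' v' u' =>
  induction l'' using LensHom.ind with | h A'' v'' u'' =>
  refine (mk_comp_ofPair _ _ _ _ _).trans
    (Eq.trans ?_ (ofPair_comp_mk _ _ _ _ _).symm)
  refine sound (α_ A A' A'').hom ?_ ?_
  · have h := tensor_associativity A Q.fst A' Q'.fst A'' Q''.fst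
    dsimp only
    simp only [comp_tensorHom_left, comp_tensorHom_right, Category.assoc]
    rw [← associator_naturality_assoc, ← h, MonoidalCategory.tensorHom_def' (α_ A A' A'').hom]
  · have h := associator_monoidal A A' A'' Q.snd Q'.snd Q''.snd
    dsimp only
    simp only [comp_tensorHom_left', comp_tensorHom_right', Category.assoc]
    rw [← cancel_epi (((A ⊗ A') ⊗ A'') ◁ (α_ Q.snd Q'.snd Q''.snd).hom),
      ← MonoidalCategory.tensorHom_def'_assoc, ← reassoc_of% h, whiskerLeft_hom_inv_assoc,
      ← associator_naturality_assoc]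
    simp

theorem LensHom.tensor_leftUnitor {P Q : LensCat C} (l : LensHom P Q) :
    (LensHom.tensor (ofPair (P := ⟨𝟙_ C, 𝟙_ C⟩) (Q := ⟨𝟙_ C, 𝟙_ C⟩) (𝟙 _) (𝟙 _)) l).comp
        (ofPair (λ_ _).hom (λ_ _).inv) =
      (ofPair (λ_ _).hom (λ_ _).inv).comp l := by
  induction l using LensHom.ind with | h A v u =>
  refine (mk_comp_ofPair _ _ _ _ _).trans
    (Eq.trans ?_ (ofPair_comp_mk _ _ _ _ _).symm)
  refine sound (λ_ A).hom ?_ ?_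
  · have h := tensor_left_unitality A Q.fst
    dsimp only
    rw [Category.assoc, Category.assoc, ← MonoidalCategory.tensorHom_def', Category.id_comp,
      MonoidalCategory.tensorHom_def', Category.assoc, ← h, leftUnitor_naturality]
  · have h := leftUnitor_monoidal A Q.snd
    dsimp only
    rw [Category.comp_id, MonoidalCategory.tensorHom_def,
      ← cancel_epi ((𝟙_ C ⊗ A) ◁ (λ_ Q.snd).hom), whiskerLeft_hom_inv_assoc,
      ← MonoidalCategory.tensorHom_def'_assoc, h]
    simp

theorem LensHom.tensor_rightUnitor {P Q : LensCat C} (l : LensHom P Q) :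
    (LensHom.tensor l (ofPair (P := ⟨𝟙_ C, 𝟙_ C⟩) (Q := ⟨𝟙_ C, 𝟙_ C⟩) (𝟙 _) (𝟙 _))).comp
        (ofPair (ρ_ _).hom (ρ_ _).inv) =
      (ofPair (ρ_ _).hom (ρ_ _).inv).comp l := by
  induction l using LensHom.ind with | h A v u =>
  refine (mk_comp_ofPair _ _ _ _ _).trans
    (Eq.trans ?_ (ofPair_comp_mk _ _ _ _ _).symm)
  refine sound (ρ_ A).hom ?_ ?_
  · have h := tensor_right_unitality A Q.fst
    dsimp only
    rw [Category.assoc, Category.assoc, ← MonoidalCategory.tensorHom_def', Category.id_comp,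
      MonoidalCategory.tensorHom_def, Category.assoc, ← h, rightUnitor_naturality]
  · have h := rightUnitor_monoidal A Q.snd
    dsimp only
    rw [Category.comp_id, MonoidalCategory.tensorHom_def',
      ← cancel_epi ((A ⊗ 𝟙_ C) ◁ (ρ_ Q.snd).hom), whiskerLeft_hom_inv_assoc,
      ← MonoidalCategory.tensorHom_def'_assoc, h]
    simp

theorem LensHom.tensor_braiding {P Q P' Q' : LensCat C} (l : LensHom P Q) (l' : LensHom P' Q') :
    (l.tensor l').comp (ofPair (β_ _ _).hom (β_ _ _).inv) =
      (ofPair (β_ _ _).hom (β_ _ _).inv).comp (l'.tensor l) := by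
  induction l using LensHom.ind with | h A v u =>
  induction l' using LensHom.ind with | h A' v' u' =>
  refine (mk_comp_ofPair _ _ _ _ _).trans
    (Eq.trans ?_ (ofPair_comp_mk _ _ _ _ _).symm)
  refine sound (β_ A A').hom ?_ ?_
  · have h := tensorμ_braiding_view A Q.fst A' Q'.fst
    dsimp only
    rw [Category.assoc, Category.assoc, ← MonoidalCategory.tensorHom_def', h,
      BraidedCategory.braiding_naturality_assoc]
  · have h := tensorμ_braiding_update A A' Q.snd Q'.snd
    dsimp only
    rw [← cancel_epi ((A ⊗ A') ◁ (β_ Q.snd Q'.snd).hom), whiskerLeft_hom_inv_assoc,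
      ← MonoidalCategory.tensorHom_def'_assoc, Category.assoc, ← reassoc_of% h,
      ← BraidedCategory.braiding_naturality_assoc]
    simp

instance LensCat.monoidalCategory : MonoidalCategory (LensCat C) :=
  MonoidalCategory.ofTensorHom
    (id_tensorHom_id := fun P Q => (ofPair_tensor_ofPair _ _ _ _).trans (by
      simp only [id_tensorHom_id]; rfl))
    (id_tensorHom := fun _ _ _ _ => rfl)
    (tensorHom_id := fun _ _ => rfl)
    (tensorHom_comp_tensorHom := fun l l' m m' => LensHom.tensor_comp_tensor l l' m m')
    (associator_naturality := fun l m n => LensHom.tensor_associator l m n)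
    (leftUnitor_naturality := fun l => LensHom.tensor_leftUnitor l)
    (rightUnitor_naturality := fun l => LensHom.tensor_rightUnitor l)
    (pentagon := fun W X Y Z => by
      refine (congrArg₂ LensHom.comp (ofPair_tensor_ofPair _ _ _ _)
        (congrArg (LensHom.comp _) (ofPair_tensor_ofPair _ _ _ _))).trans ?_
      refine (congrArg (LensHom.comp _) (ofPair_comp_ofPair _ _ _ _)).trans
        ((ofPair_comp_ofPair _ _ _ _).trans (Eq.trans ?_ (ofPair_comp_ofPair _ _ _ _).symm))
      congr 1
      · rw [id_tensorHom, tensorHom_id]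
        exact pentagon W.fst X.fst Y.fst Z.fst
      · rw [Category.assoc, id_tensorHom, tensorHom_id]
        exact pentagon_inv (W := W.snd) (X := X.snd) (Y := Y.snd) (Z := Z.snd))
    (triangle := fun X Y => by
      refine (congrArg (LensHom.comp _) (ofPair_tensor_ofPair _ _ _ _)).trans
        ((ofPair_comp_ofPair _ _ _ _).trans (Eq.trans ?_ (ofPair_tensor_ofPair _ _ _ _).symm))
      congr 1
      · rw [id_tensorHom, tensorHom_id]
        exact triangle X.fst Y.fst
      · rw [id_tensorHom, tensorHom_id]
        exact triangle_assoc_comp_left_inv X.snd Y.snd)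

instance LensCat.symmetricCategory : SymmetricCategory (LensCat C) where
  braiding P Q := LensCat.isoOfPair (β_ P.fst Q.fst) (β_ P.snd Q.snd)
  braiding_naturality_right P _ _ m := LensHom.tensor_braiding (𝟙 P : P ⟶ P) m
  braiding_naturality_left l P := LensHom.tensor_braiding l (𝟙 P : P ⟶ P)
  hexagon_forward X Y Z := by
    refine (congrArg (LensHom.comp _) (ofPair_comp_ofPair _ _ _ _)).trans
      ((ofPair_comp_ofPair _ _ _ _).trans (Eq.trans ?_
        ((congrArg₂ LensHom.comp (ofPair_tensor_ofPair _ _ _ _)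
          ((congrArg (LensHom.comp _) (ofPair_tensor_ofPair _ _ _ _)).trans
            (ofPair_comp_ofPair _ _ _ _))).trans (ofPair_comp_ofPair _ _ _ _)).symm))
    congr 1
    · rw [id_tensorHom, tensorHom_id]
      exact BraidedCategory.hexagon_forward X.fst Y.fst Z.fst
    · rw [id_tensorHom, tensorHom_id, Category.assoc, Category.assoc]
      exact BraidedCategory.hexagon_forward_inv X.snd Y.snd Z.snd
  hexagon_reverse X Y Z := by
    refine (congrArg (LensHom.comp _) (ofPair_comp_ofPair _ _ _ _)).trans
      ((ofPair_comp_ofPair _ _ _ _).trans (Eq.trans ?_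
        ((congrArg₂ LensHom.comp (ofPair_tensor_ofPair _ _ _ _)
          ((congrArg (LensHom.comp _) (ofPair_tensor_ofPair _ _ _ _)).trans
            (ofPair_comp_ofPair _ _ _ _))).trans (ofPair_comp_ofPair _ _ _ _)).symm))
    congr 1
    · rw [id_tensorHom, tensorHom_id]
      exact BraidedCategory.hexagon_reverse X.fst Y.fst Z.fst
    · rw [id_tensorHom, tensorHom_id, Category.assoc, Category.assoc]
      exact BraidedCategory.hexagon_reverse_inv X.snd Y.snd Z.snd
  symmetry X Y := by
    refine (ofPair_comp_ofPair _ _ _ _).trans ?_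
    have h : (β_ Y.snd X.snd).inv ≫ (β_ X.snd Y.snd).inv = 𝟙 _ := by
      rw [← SymmetricCategory.braiding_swap_eq_inv_braiding,
        ← SymmetricCategory.braiding_swap_eq_inv_braiding, SymmetricCategory.symmetry]
    exact congrArg₂ ofPair (SymmetricCategory.symmetry X.fst Y.fst) h

end LensHom

section OpenGames

variable {C : Type u} [Category.{v} C] [MonoidalCategory C] [SymmetricCategory C]

/-- Contexts: states of `(Φ, Ψ)` in the double lens category, i.e. elements of
`∫^Θ Lens(I, Θ ⊗ Φ) × Lens(Θ ⊗ Ψ, I)`. -/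
def GameContext (Φ Ψ : LensCat C) : Type (max u v) :=
  𝟙_ (LensCat (LensCat C)) ⟶ (⟨Φ, Ψ⟩ : LensCat (LensCat C))

namespace GameContext

/-- The context `[p, k]` with bound object `Θ`. -/
def mk {Φ Ψ : LensCat C} (Θ : LensCat C) (p : 𝟙_ (LensCat C) ⟶ Θ ⊗ Φ)
    (k : Θ ⊗ Ψ ⟶ 𝟙_ (LensCat C)) : GameContext Φ Ψ :=
  LensHom.mk (P := 𝟙_ (LensCat (LensCat C))) (Q := ⟨Φ, Ψ⟩) Θ p k

theorem slide {Φ Ψ Θ Θ' : LensCat C} (f : Θ ⟶ Θ') (p : 𝟙_ (LensCat C) ⟶ Θ ⊗ Φ)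
    (k : Θ' ⊗ Ψ ⟶ 𝟙_ (LensCat C)) : mk Θ' (p ≫ f ▷ Φ) k = mk Θ p (f ▷ Ψ ≫ k) :=
  LensHom.slide (P := 𝟙_ (LensCat (LensCat C))) (Q := ⟨Φ, Ψ⟩) f p k

/-- Functions out of contexts are functions of `(Θ, p, k)` that respect sliding. -/
def lift {Φ Ψ : LensCat C} {T : Type w}
    (d : ∀ Θ : LensCat C, (𝟙_ (LensCat C) ⟶ Θ ⊗ Φ) → (Θ ⊗ Ψ ⟶ 𝟙_ (LensCat C)) → T)
    (hd : ∀ {Θ Θ' : LensCat C} (f : Θ ⟶ Θ') (p : 𝟙_ (LensCat C) ⟶ Θ ⊗ Φ)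
      (k : Θ' ⊗ Ψ ⟶ 𝟙_ (LensCat C)), d Θ' (p ≫ f ▷ Φ) k = d Θ p (f ▷ Ψ ≫ k)) :
    GameContext Φ Ψ → T :=
  Quot.lift (fun x => d x.bound x.view x.update) (by
    rintro _ _ ⟨f, p, k⟩
    exact hd f p k)

theorem lift_mk {Φ Ψ : LensCat C} {T : Type w}
    (d : ∀ Θ : LensCat C, (𝟙_ (LensCat C) ⟶ Θ ⊗ Φ) → (Θ ⊗ Ψ ⟶ 𝟙_ (LensCat C)) → T) (hd)
    (Θ : LensCat C) (p : 𝟙_ (LensCat C) ⟶ Θ ⊗ Φ) (k : Θ ⊗ Ψ ⟶ 𝟙_ (LensCat C)) :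
    lift d hd (mk Θ p k) = d Θ p k := rfl

/-- Functoriality of contexts: `[p, k] ↦ [(id_Θ ⊗ l) ∘ p, k ∘ (id_Θ ⊗ m)]`. -/
def map {Φ Φ' Ψ Ψ' : LensCat C} (l : Φ ⟶ Φ') (m : Ψ' ⟶ Ψ) :
    GameContext Φ Ψ → GameContext Φ' Ψ' :=
  lift (fun Θ p k => mk Θ (p ≫ Θ ◁ l) (Θ ◁ m ≫ k)) (by
    intro Θ Θ' f p k
    rw [Category.assoc, ← whisker_exchange, ← Category.assoc, slide, whisker_exchange_assoc])

/-- The left local context: `l : Φ' ⟶ Ψ'` is applied to the state, and its output `Ψ'` is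
bound together with `Θ`. -/
def left {Φ Φ' Ψ Ψ' : LensCat C} (c : GameContext (Φ ⊗ Φ') (Ψ ⊗ Ψ')) (l : Φ' ⟶ Ψ') :
    GameContext Φ Ψ :=
  lift (fun Θ p k => mk (Θ ⊗ Ψ')
      (p ≫ Θ ◁ (Φ ◁ l ≫ (β_ Φ Ψ').hom) ≫ (α_ Θ Ψ' Φ).inv)
      ((α_ Θ Ψ' Ψ).hom ≫ Θ ◁ (β_ Ψ' Ψ).hom ≫ k)) (by
    intro Θ Θ' f p k
    have h := slide (f ▷ Ψ') (p ≫ Θ ◁ (Φ ◁ l ≫ (β_ Φ Ψ').hom) ≫ (α_ Θ Ψ' Φ).inv)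
      ((α_ Θ' Ψ' Ψ).hom ≫ Θ' ◁ (β_ Ψ' Ψ).hom ≫ k)
    rw [Category.assoc, Category.assoc, ← associator_inv_naturality_left,
      associator_naturality_left_assoc, ← whisker_exchange_assoc f (β_ Ψ' Ψ).hom] at h
    rw [Category.assoc, ← whisker_exchange_assoc]
    exact h) c

/-- The right local context: `l : Φ ⟶ Ψ` is applied to the state, and its output `Ψ` is
bound together with `Θ`. -/
def right {Φ Φ' Ψ Ψ' : LensCat C} (c : GameContext (Φ ⊗ Φ') (Ψ ⊗ Ψ')) (l : Φ ⟶ Ψ) :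
    GameContext Φ' Ψ' :=
  lift (fun Θ p k => mk (Θ ⊗ Ψ)
      (p ≫ Θ ◁ (l ▷ Φ') ≫ (α_ Θ Ψ Φ').inv)
      ((α_ Θ Ψ Ψ').hom ≫ k)) (by
    intro Θ Θ' f p k
    have h := slide (f ▷ Ψ) (p ≫ Θ ◁ (l ▷ Φ') ≫ (α_ Θ Ψ Φ').inv) ((α_ Θ' Ψ Ψ').hom ≫ k)
    rw [Category.assoc, Category.assoc, ← associator_inv_naturality_left,
      whisker_exchange_assoc, associator_naturality_left_assoc] at h
    rw [Category.assoc]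
    exact h) c

end GameContext

/-- Open games `Φ ⟶ Ψ`. The relation `br c` on strategies is given by its sets of successors:
`σ' ∈ br c σ` says that `σ` is related to `σ'` in the context `c`. -/
structure OpenGame (Φ Ψ : LensCat C) where
  Strategy : Type w
  play : Strategy → (Φ ⟶ Ψ)
  br : GameContext Φ Ψ → Strategy → Set Strategy

namespace OpenGame

/-- The atom whose only strategy is the lens `l` (represented by the point of `PUnit`), which is
related to itself in all contexts. -/
def single {Φ Ψ : LensCat C} (l : Φ ⟶ Ψ) : OpenGame.{w} Φ Ψ where
  Strategy := PUnit
  play _ := l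
  br _ _ := Set.univ

/-- The computation `⟨f, g⟩ : (X, S) ⟶ (Y, R)` of `f : X ⟶ Y` and `g : R ⟶ S`. -/
def computation {Φ Ψ : LensCat C} (f : Φ.fst ⟶ Ψ.fst) (g : Ψ.snd ⟶ Φ.snd) : OpenGame.{w} Φ Ψ :=
  single (LensHom.ofPair f g)

/-- Sequential composition, in diagrammatic order. -/
def comp {Φ Ψ Ξ : LensCat C} (G : OpenGame.{w} Φ Ψ) (H : OpenGame.{w} Ψ Ξ) :
    OpenGame.{w} Φ Ξ where
  Strategy := G.Strategy × H.Strategy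
  play s := G.play s.1 ≫ H.play s.2
  br c s := G.br (c.map (𝟙 Φ) (H.play s.2)) s.1 ×ˢ H.br (c.map (G.play s.1) (𝟙 Ξ)) s.2

/-- Parallel composition. -/
def tensor {Φ Ψ Φ' Ψ' : LensCat C} (G : OpenGame.{w} Φ Ψ) (H : OpenGame.{w} Φ' Ψ') :
    OpenGame.{w} (Φ ⊗ Φ') (Ψ ⊗ Ψ') where
  Strategy := G.Strategy × H.Strategy
  play s := G.play s.1 ⊗ₘ H.play s.2
  br c s := G.br (c.left (H.play s.2)) s.1 ×ˢ H.br (c.right (G.play s.1)) s.2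

/-- Simulations: serial relations that preserve play and are compatible with best response. -/
structure IsSimulation {Φ Ψ : LensCat C} (G H : OpenGame.{w} Φ Ψ)
    (α : G.Strategy → H.Strategy → Prop) : Prop where
  serial : ∀ σ, ∃ τ, α σ τ
  play_eq : ∀ σ τ, α σ τ → G.play σ = H.play τ
  br_of_br : ∀ (c : GameContext Φ Ψ) σ σ' τ, α σ τ → σ' ∈ G.br c σ →
    ∃ τ', α σ' τ' ∧ τ' ∈ H.br c τ

/-- Equivalence of open games: there is a bisimulation between them. -/
def Equivalent {Φ Ψ : LensCat C} (G H : OpenGame.{w} Φ Ψ) : Prop :=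
  ∃ α : G.Strategy → H.Strategy → Prop, IsSimulation G H α ∧ IsSimulation H G (flip α)

theorem IsSimulation.refl {Φ Ψ : LensCat C} (G : OpenGame.{w} Φ Ψ) :
    IsSimulation G G (fun σ τ => σ = τ) where
  serial σ := ⟨σ, rfl⟩
  play_eq := by rintro σ _ rfl; rfl
  br_of_br := by rintro c σ σ' _ rfl h; exact ⟨σ', rfl, h⟩

theorem IsSimulation.trans {Φ Ψ : LensCat C} {G H K : OpenGame.{w} Φ Ψ}
    {α : G.Strategy → H.Strategy → Prop} {β : H.Strategy → K.Strategy → Prop}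
    (hα : IsSimulation G H α) (hβ : IsSimulation H K β) :
    IsSimulation G K (fun σ μ => ∃ τ, α σ τ ∧ β τ μ) where
  serial σ := by
    obtain ⟨τ, h⟩ := hα.serial σ
    obtain ⟨μ, h'⟩ := hβ.serial τ
    exact ⟨μ, τ, h, h'⟩
  play_eq := by
    rintro σ μ ⟨τ, h, h'⟩
    exact (hα.play_eq _ _ h).trans (hβ.play_eq _ _ h')
  br_of_br := by
    rintro c σ σ' μ ⟨τ, h, h'⟩ hσ
    obtain ⟨τ', k, hτ⟩ := hα.br_of_br c _ _ _ h hσ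
    obtain ⟨μ', k', hμ⟩ := hβ.br_of_br c _ _ _ h' hτ
    exact ⟨μ', ⟨τ', k, k'⟩, hμ⟩

theorem equivalent_equivalence (Φ Ψ : LensCat C) :
    Equivalence (Equivalent (Φ := Φ) (Ψ := Ψ) (C := C)) where
  refl G := ⟨_, IsSimulation.refl G, by
    have h : flip (fun σ τ : G.Strategy => σ = τ) = fun σ τ => σ = τ := by
      funext σ τ
      exact propext eq_comm
    rw [h]
    exact IsSimulation.refl G⟩
  symm := by
    rintro G H ⟨α, h, h'⟩
    exact ⟨flip α, h', h⟩
  trans := by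
    rintro G H K ⟨α, h, h'⟩ ⟨β, k, k'⟩
    refine ⟨_, h.trans k, ?_⟩
    convert k'.trans h' using 1
    funext μ σ
    exact propext ⟨fun ⟨τ, x, y⟩ => ⟨τ, y, x⟩, fun ⟨τ, x, y⟩ => ⟨τ, y, x⟩⟩

theorem IsSimulation.comp {Φ Ψ Ξ : LensCat C} {G G' : OpenGame.{w} Φ Ψ} {H H' : OpenGame.{w} Ψ Ξ}
    {α : G.Strategy → G'.Strategy → Prop} {β : H.Strategy → H'.Strategy → Prop}
    (hα : IsSimulation G G' α) (hβ : IsSimulation H H' β) :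
    IsSimulation (G.comp H) (G'.comp H') (fun s t => α s.1 t.1 ∧ β s.2 t.2) where
  serial s := by
    obtain ⟨τ, h⟩ := hα.serial s.1
    obtain ⟨μ, h'⟩ := hβ.serial s.2
    exact ⟨(τ, μ), h, h'⟩
  play_eq := by
    rintro s t ⟨h, h'⟩
    exact congrArg₂ (· ≫ ·) (hα.play_eq _ _ h) (hβ.play_eq _ _ h')
  br_of_br := by
    rintro c s s' t ⟨h, h'⟩ ⟨k, k'⟩
    rw [hβ.play_eq _ _ h'] at k
    rw [hα.play_eq _ _ h] at k'
    obtain ⟨τ, x, y⟩ := hα.br_of_br _ _ _ _ h k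
    obtain ⟨μ, x', y'⟩ := hβ.br_of_br _ _ _ _ h' k'
    exact ⟨(τ, μ), ⟨x, x'⟩, y, y'⟩

theorem IsSimulation.tensor {Φ Ψ Φ' Ψ' : LensCat C} {G G' : OpenGame.{w} Φ Ψ}
    {H H' : OpenGame.{w} Φ' Ψ'}
    {α : G.Strategy → G'.Strategy → Prop} {β : H.Strategy → H'.Strategy → Prop}
    (hα : IsSimulation G G' α) (hβ : IsSimulation H H' β) :
    IsSimulation (G.tensor H) (G'.tensor H') (fun s t => α s.1 t.1 ∧ β s.2 t.2) where
  serial s := by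
    obtain ⟨τ, h⟩ := hα.serial s.1
    obtain ⟨μ, h'⟩ := hβ.serial s.2
    exact ⟨(τ, μ), h, h'⟩
  play_eq := by
    rintro s t ⟨h, h'⟩
    exact congrArg₂ (· ⊗ₘ ·) (hα.play_eq _ _ h) (hβ.play_eq _ _ h')
  br_of_br := by
    rintro c s s' t ⟨h, h'⟩ ⟨k, k'⟩
    rw [hβ.play_eq _ _ h'] at k
    rw [hα.play_eq _ _ h] at k'
    obtain ⟨τ, x, y⟩ := hα.br_of_br _ _ _ _ h k
    obtain ⟨μ, x', y'⟩ := hβ.br_of_br _ _ _ _ h' k'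
    exact ⟨(τ, μ), ⟨x, x'⟩, y, y'⟩

theorem Equivalent.comp {Φ Ψ Ξ : LensCat C} {G G' : OpenGame.{w} Φ Ψ} {H H' : OpenGame.{w} Ψ Ξ}
    (hG : Equivalent G G') (hH : Equivalent H H') : Equivalent (G.comp H) (G'.comp H') := by
  obtain ⟨α, h, h'⟩ := hG
  obtain ⟨β, k, k'⟩ := hH
  exact ⟨_, h.comp k, h'.comp k'⟩

theorem Equivalent.tensor {Φ Ψ Φ' Ψ' : LensCat C} {G G' : OpenGame.{w} Φ Ψ}
    {H H' : OpenGame.{w} Φ' Ψ'} (hG : Equivalent G G') (hH : Equivalent H H') :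
    Equivalent (G.tensor H) (G'.tensor H') := by
  obtain ⟨α, h, h'⟩ := hG
  obtain ⟨β, k, k'⟩ := hH
  exact ⟨_, h.tensor k, h'.tensor k'⟩

/-- Open games `Φ ⟶ Ψ` up to bisimulation. -/
instance setoid (Φ Ψ : LensCat C) : Setoid (OpenGame.{w} Φ Ψ) :=
  ⟨Equivalent, equivalent_equivalence Φ Ψ⟩

end OpenGame

/-- Equivalence classes of open games `Φ ⟶ Ψ`. -/
def GameClass (Φ Ψ : LensCat C) : Type (max u v (w + 1)) :=
  Quotient (OpenGame.setoid.{w} Φ Ψ)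

namespace GameClass

/-- The equivalence class of an open game. -/
def mk {Φ Ψ : LensCat C} (G : OpenGame.{w} Φ Ψ) : GameClass.{w} Φ Ψ :=
  Quotient.mk _ G

/-- Sequential composition of classes, in diagrammatic order. -/
def comp {Φ Ψ Ξ : LensCat C} : GameClass.{w} Φ Ψ → GameClass.{w} Ψ Ξ → GameClass.{w} Φ Ξ :=
  Quotient.map₂ OpenGame.comp (fun _ _ h _ _ k => OpenGame.Equivalent.comp h k)

/-- Tensor of classes. -/
def tensor {Φ Ψ Φ' Ψ' : LensCat C} :
    GameClass.{w} Φ Ψ → GameClass.{w} Φ' Ψ' → GameClass.{w} (Φ ⊗ Φ') (Ψ ⊗ Ψ') :=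
  Quotient.map₂ OpenGame.tensor (fun _ _ h _ _ k => OpenGame.Equivalent.tensor h k)

end GameClass

end OpenGames

/-- The data (without axioms) of a symmetric monoidal category with the given objects.
Whiskering is not listed, since it is tensoring with an identity, and neither are the inverses
of the structural isomorphisms. -/
structure SymmetricMonoidalData (Ob : Type u) where
  Hom : Ob → Ob → Type v
  id : ∀ X, Hom X X
  comp : ∀ {X Y Z}, Hom X Y → Hom Y Z → Hom X Z
  tensorObj : Ob → Ob → Ob
  tensorHom : ∀ {X Y X' Y'}, Hom X Y → Hom X' Y' → Hom (tensorObj X X') (tensorObj Y Y')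
  tensorUnit : Ob
  associator : ∀ X Y Z, Hom (tensorObj (tensorObj X Y) Z) (tensorObj X (tensorObj Y Z))
  leftUnitor : ∀ X, Hom (tensorObj tensorUnit X) X
  rightUnitor : ∀ X, Hom (tensorObj X tensorUnit) X
  braiding : ∀ X Y, Hom (tensorObj X Y) (tensorObj Y X)

/-- The data underlying a symmetric monoidal category. -/
def SymmetricMonoidalData.ofSymmetricCategory (D : Type u) [Category.{v} D] [MonoidalCategory D]
    [SymmetricCategory D] : SymmetricMonoidalData.{v} D where
  Hom X Y := X ⟶ Y
  id X := 𝟙 X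
  comp f g := f ≫ g
  tensorObj X Y := X ⊗ Y
  tensorHom f g := f ⊗ₘ g
  tensorUnit := 𝟙_ D
  associator X Y Z := (α_ X Y Z).hom
  leftUnitor X := (λ_ X).hom
  rightUnitor X := (ρ_ X).hom
  braiding X Y := (β_ X Y).hom

/-- Objects of the category of open games: pairs of objects of `C`, as for lenses. -/
def GameCat (C : Type u) : Type u := LensCat C

/-- The operations on equivalence classes of open games. The structural morphisms are the
computations `⟨α, α⁻¹⟩`, `⟨λ, λ⁻¹⟩`, `⟨ρ, ρ⁻¹⟩` and `⟨s_{X,Y}, s_{B,A}⟩`. -/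
def gameData (C : Type u) [Category.{v} C] [MonoidalCategory C] [SymmetricCategory C] :
    SymmetricMonoidalData.{max u v (w + 1)} (GameCat C) where
  Hom Φ Ψ := GameClass.{w} (C := C) Φ Ψ
  id Φ := GameClass.mk (OpenGame.single (𝟙 (show LensCat C from Φ)))
  comp G H := GameClass.comp G H
  tensorObj Φ Ψ := LensCat.mk (LensCat.fst Φ ⊗ LensCat.fst Ψ) (LensCat.snd Φ ⊗ LensCat.snd Ψ)
  tensorHom G H := GameClass.tensor G H
  tensorUnit := LensCat.mk (𝟙_ C) (𝟙_ C)
  associator Φ Ψ Ξ := GameClass.mk (OpenGame.computation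
    (α_ (LensCat.fst Φ) (LensCat.fst Ψ) (LensCat.fst Ξ)).hom
    (α_ (LensCat.snd Φ) (LensCat.snd Ψ) (LensCat.snd Ξ)).inv)
  leftUnitor Φ := GameClass.mk
    (OpenGame.computation (λ_ (LensCat.fst Φ)).hom (λ_ (LensCat.snd Φ)).inv)
  rightUnitor Φ := GameClass.mk
    (OpenGame.computation (ρ_ (LensCat.fst Φ)).hom (ρ_ (LensCat.snd Φ)).inv)
  braiding Φ Ψ := GameClass.mk (OpenGame.computation
    (β_ (LensCat.fst Φ) (LensCat.fst Ψ)).hom (β_ (LensCat.snd Ψ) (LensCat.snd Φ)).hom)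

/-! A bijection between strategy sets that respects play and best response is a bisimulation
(`Equivalent.of_equiv`), so each axiom for games reduces to two checks over the evident rebracketing
of strategies. Play must satisfy the axiom, which is the same axiom in the lens category. Each
player must also face the same context on both sides, which is an identity between elements of a
coend.

The context identities are the substance. `map` is functorial, which gives associativity and the
unit laws of composition. Interchange rests on `left_map_tensor` and `right_map_tensor`: local
contexts commute with `map` along tensors, the other player's part of the map being absorbed into
the lens that fills its hole. Naturality of the associator rests on `left_left`, `left_right` and
`right_right`, one for each of three players. The unitors and the symmetry need `right_leftUnitor`,
`left_rightUnitor`, `left_braiding` and `right_braiding`.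

Each identity about local contexts is a single slide: the two sides have representatives whose bound
objects are compared by one morphism, usually a reordering of factors, and it remains to compare the
state halves and the continuation halves in a symmetric monoidal category.

The coherence diagrams involve only games given by lenses. Since `single` preserves composition,
identities and tensor up to bisimulation, these diagrams are inherited from lenses. -/

/-! ### Reorderings of bound objects in a symmetric monoidal category -/

section Associativity

variable {D : Type u} [Category.{v} D] [MonoidalCategory D]

/-- State half of the slide in `right_right`, with `T` the bound object of the given context. The
order of the factors never changes, so no braiding is needed. The lemmas ending in `_update` are the
corresponding continuation halves. -/
theorem right_right_view (T : D) {A B E A' B' : D} (g : A ⟶ A') (h : B ⟶ B') :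
    (T ◁ ((g ⊗ₘ h) ▷ E) ≫ (α_ T (A' ⊗ B') E).inv) ≫ (α_ T A' B').inv ▷ E =
      T ◁ (α_ A B E).hom ≫ T ◁ (g ▷ (B ⊗ E)) ≫ (α_ T A' (B ⊗ E)).inv ≫
        (T ⊗ A') ◁ (h ▷ E) ≫ (α_ (T ⊗ A') B' E).inv := by
  simp [MonoidalCategory.tensorHom_def]

theorem right_right_update (T A B E : D) :
    (α_ T (A ⊗ B) E).hom ≫ T ◁ (α_ A B E).hom =
      (α_ T A B).inv ▷ E ≫ (α_ (T ⊗ A) B E).hom ≫ (α_ T A (B ⊗ E)).hom := by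
  simp

variable [SymmetricCategory D]

/-- Both sides carry `A`, `B`, `E` to the order `B`, `E`, `A`. On the left `B` and `E` cross twice,
and these crossings cancel by symmetry. -/
theorem braiding_tensor_braiding (A B E : D) :
    (β_ (A ⊗ B) E).hom ≫ E ◁ (β_ A B).hom ≫ (α_ E B A).inv ≫ (β_ E B).hom ▷ A =
      (α_ A B E).hom ≫ (β_ A (B ⊗ E)).hom := by
  rw [← BraidedCategory.braiding_naturality_left_assoc]
  simp [← comp_whiskerRight]

theorem left_left_swap {A B E B' E' : D} (h : B ⟶ B') (k : E ⟶ E') :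
    (A ⊗ B) ◁ k ≫ (β_ (A ⊗ B) E').hom ≫ E' ◁ (A ◁ h ≫ (β_ A B').hom) ≫ (α_ E' B' A).inv ≫
        (β_ E' B').hom ▷ A =
      (α_ A B E).hom ≫ A ◁ (h ⊗ₘ k) ≫ (β_ A (B' ⊗ E')).hom := by
  rw [whiskerLeft_comp, Category.assoc, ← BraidedCategory.braiding_naturality_left_assoc,
    braiding_tensor_braiding]
  simp [MonoidalCategory.tensorHom_def']

theorem left_left_view (T : D) {A B E B' E' : D} (h : B ⟶ B') (k : E ⟶ E') :
    (T ◁ ((A ⊗ B) ◁ k ≫ (β_ (A ⊗ B) E').hom) ≫ (α_ T E' (A ⊗ B)).inv ≫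
      (T ⊗ E') ◁ (A ◁ h ≫ (β_ A B').hom) ≫ (α_ (T ⊗ E') B' A).inv) ≫
        ((α_ T E' B').hom ≫ T ◁ (β_ E' B').hom) ▷ A =
      T ◁ (α_ A B E).hom ≫ T ◁ (A ◁ (h ⊗ₘ k) ≫ (β_ A (B' ⊗ E')).hom) ≫
        (α_ T (B' ⊗ E') A).inv := by
  have e := congrArg (fun q => T ◁ q ≫ (α_ T (B' ⊗ E') A).inv) (left_left_swap (A := A) h k)
  simp only [whiskerLeft_comp, Category.assoc] at e ⊢
  rw [← e]
  simp

/-- Both sides reverse `E`, `B`, `A`, starting from different transpositions. Their agreement is the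
Yang–Baxter equation. -/
theorem left_left_update (T A B E : D) :
    (α_ (T ⊗ E) B A).hom ≫ (T ⊗ E) ◁ (β_ B A).hom ≫ (α_ T E (A ⊗ B)).hom ≫
      T ◁ (β_ E (A ⊗ B)).hom ≫ T ◁ (α_ A B E).hom =
    ((α_ T E B).hom ≫ T ◁ (β_ E B).hom) ▷ A ≫ (α_ T (B ⊗ E) A).hom ≫ T ◁ (β_ (B ⊗ E) A).hom := by
  have yb := congrArg (fun q => T ◁ q) (BraidedCategory.yang_baxter E B A)
  simp only [whiskerLeft_comp] at yb
  simp [← yb]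

/-- The factor `E'` is carried past both `A'` and `B` and then back across `A'`. By the hexagon and
symmetry only its crossing with `B` survives. -/
theorem left_right_swap {A B E A' E' : D} (g : A ⟶ A') (k : E ⟶ E') :
    (A ⊗ B) ◁ k ≫ (β_ (A ⊗ B) E').hom ≫ E' ◁ (g ▷ B) ≫ (α_ E' A' B).inv ≫
        (β_ E' A').hom ▷ B ≫ (α_ A' E' B).hom =
      (α_ A B E).hom ≫ g ▷ (B ⊗ E) ≫ A' ◁ (B ◁ k ≫ (β_ B E').hom) := by
  rw [← BraidedCategory.braiding_naturality_left_assoc, BraidedCategory.braiding_tensor_left_hom]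
  simp only [Category.assoc, Iso.hom_inv_id_assoc, ← comp_whiskerRight_assoc,
    SymmetricCategory.symmetry, id_whiskerRight, Category.id_comp, Iso.inv_hom_id, Category.comp_id,
    whiskerLeft_comp, tensor_whiskerLeft, whiskerRight_tensor]
  rw [← associator_inv_naturality_left_assoc, whisker_exchange_assoc]
  simp

theorem left_right_view (T : D) {A B E A' E' : D} (g : A ⟶ A') (k : E ⟶ E') :
    (T ◁ ((A ⊗ B) ◁ k ≫ (β_ (A ⊗ B) E').hom) ≫ (α_ T E' (A ⊗ B)).inv ≫
      (T ⊗ E') ◁ (g ▷ B) ≫ (α_ (T ⊗ E') A' B).inv) ≫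
        ((α_ T E' A').hom ≫ T ◁ (β_ E' A').hom ≫ (α_ T A' E').inv) ▷ B =
      T ◁ (α_ A B E).hom ≫ T ◁ (g ▷ (B ⊗ E)) ≫ (α_ T A' (B ⊗ E)).inv ≫
        (T ⊗ A') ◁ (B ◁ k ≫ (β_ B E').hom) ≫ (α_ (T ⊗ A') E' B).inv := by
  have e := congrArg (fun q => T ◁ q ≫ (α_ T A' (E' ⊗ B)).inv ≫ (α_ (T ⊗ A') E' B).inv)
    (left_right_swap (B := B) g k)
  simp only [whiskerLeft_comp, Category.assoc] at e
  -- Whiskering by `T ⊗ A'` is unfolded into two whiskerings, so that the right-hand side ends in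
  -- the form produced by `left_right_swap` under `T`.
  have e' : (T ⊗ A') ◁ (B ◁ k ≫ (β_ B E').hom) ≫ (α_ (T ⊗ A') E' B).inv =
      (α_ T A' (B ⊗ E)).hom ≫ T ◁ A' ◁ B ◁ k ≫ T ◁ A' ◁ (β_ B E').hom ≫
        (α_ T A' (E' ⊗ B)).inv ≫ (α_ (T ⊗ A') E' B).inv := by
    simp only [tensor_whiskerLeft, whiskerLeft_comp, Category.assoc, Iso.inv_hom_id_assoc]
  rw [e', Iso.inv_hom_id_assoc, ← e]
  simp

/-- By the hexagon, crossing `A ⊗ B` is crossing `A` and then `B`. -/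
theorem left_right_update (T A B E : D) :
    (α_ (T ⊗ E) A B).hom ≫ (α_ T E (A ⊗ B)).hom ≫
      T ◁ (β_ E (A ⊗ B)).hom ≫ T ◁ (α_ A B E).hom =
    ((α_ T E A).hom ≫ T ◁ (β_ E A).hom ≫ (α_ T A E).inv) ▷ B ≫
      (α_ (T ⊗ A) E B).hom ≫ (T ⊗ A) ◁ (β_ E B).hom ≫ (α_ T A (B ⊗ E)).hom := by
  simp

end Associativity

/-! ### Identities between local contexts -/

section LocalContexts

variable {C : Type u} [Category.{v} C] [MonoidalCategory C] [SymmetricCategory C]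

namespace GameContext

theorem ind {Φ Ψ : LensCat C} {q : GameContext Φ Ψ → Prop}
    (h : ∀ (Θ : LensCat C) (p : 𝟙_ (LensCat C) ⟶ Θ ⊗ Φ) (k : Θ ⊗ Ψ ⟶ 𝟙_ (LensCat C)),
      q (mk Θ p k)) (c) : q c :=
  Quot.ind (fun x => h x.bound x.view x.update) c

/-- Form of the generating relation used for all local context identities: `f` compares the bound
objects, leaving one equation for states and one for continuations. -/
theorem sound {Φ Ψ Θ Θ' : LensCat C} (f : Θ ⟶ Θ') {p : 𝟙_ (LensCat C) ⟶ Θ ⊗ Φ}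
    {k : Θ ⊗ Ψ ⟶ 𝟙_ (LensCat C)} {p' : 𝟙_ (LensCat C) ⟶ Θ' ⊗ Φ} {k' : Θ' ⊗ Ψ ⟶ 𝟙_ (LensCat C)}
    (hp : p ≫ f ▷ Φ = p') (hk : k = f ▷ Ψ ≫ k') : mk Θ p k = mk Θ' p' k' := by
  subst hp hk
  exact (slide f p k').symm

theorem map_mk {Φ Φ' Ψ Ψ' : LensCat C} (l : Φ ⟶ Φ') (m : Ψ' ⟶ Ψ) (Θ : LensCat C)
    (p : 𝟙_ (LensCat C) ⟶ Θ ⊗ Φ) (k : Θ ⊗ Ψ ⟶ 𝟙_ (LensCat C)) :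
    (mk Θ p k).map l m = mk Θ (p ≫ Θ ◁ l) (Θ ◁ m ≫ k) := rfl

theorem map_id {Φ Ψ : LensCat C} (c : GameContext Φ Ψ) : c.map (𝟙 Φ) (𝟙 Ψ) = c := by
  induction c using ind with | h Θ p k =>
  simp [map_mk]

theorem map_map {Φ Φ' Φ'' Ψ Ψ' Ψ'' : LensCat C} (l : Φ ⟶ Φ') (m : Ψ' ⟶ Ψ) (l' : Φ' ⟶ Φ'')
    (m' : Ψ'' ⟶ Ψ') (c : GameContext Φ Ψ) : (c.map l m).map l' m' = c.map (l ≫ l') (m' ≫ m) := by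
  induction c using ind with | h Θ p k =>
  simp [map_mk]

/-- On the left `m'` is applied to the bound output of `h` by the continuation; on the right it is
already part of the state. Sliding along `m'` moves it from one to the other, and the rest is
naturality of the braiding. -/
theorem left_map_tensor {Φ Φ' Ψ Ψ' Ξ Ξ' Ω Ω' : LensCat C} (l : Φ ⟶ Ψ) (l' : Φ' ⟶ Ψ')
    (m : Ξ ⟶ Ω) (m' : Ξ' ⟶ Ω') (h : Ψ' ⟶ Ξ') (c : GameContext (Φ ⊗ Φ') (Ω ⊗ Ω')) :
    (c.map (l ⊗ₘ l') (m ⊗ₘ m')).left h = (c.left (l' ≫ h ≫ m')).map l m := by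
  induction c using ind with | h Θ p k =>
  refine sound (Θ ◁ m') ?_ ?_
  · have e : (l ⊗ₘ l') ≫ Ψ ◁ h ≫ (β_ Ψ Ξ').hom ≫ m' ▷ Ψ =
        Φ ◁ (l' ≫ h ≫ m') ≫ (β_ Φ Ω').hom ≫ Ω' ◁ l := by
      rw [← BraidedCategory.braiding_naturality_right, ← BraidedCategory.braiding_naturality_left,
        whisker_exchange_assoc, MonoidalCategory.tensorHom_def]
      simp only [whiskerLeft_comp, Category.assoc]
    have e' := congrArg (fun q => p ≫ Θ ◁ q ≫ (α_ Θ Ω' Ψ).inv) e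
    simp only [whiskerLeft_comp, Category.assoc] at e' ⊢
    rw [← associator_inv_naturality_middle, ← associator_inv_naturality_right, e']
  · have e : (β_ Ξ' Ξ).hom ≫ (m ⊗ₘ m') = Ξ' ◁ m ≫ m' ▷ Ω ≫ (β_ Ω' Ω).hom := by
      rw [BraidedCategory.braiding_naturality_left, BraidedCategory.braiding_naturality_right_assoc,
        MonoidalCategory.tensorHom_def]
    rw [← whiskerLeft_comp_assoc, e]
    simp only [whiskerLeft_comp, Category.assoc, tensor_whiskerLeft, Iso.inv_hom_id_assoc]
    rw [associator_naturality_middle_assoc, ← whiskerLeft_comp_assoc Θ (m' ▷ Ξ),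
      ← whisker_exchange, whiskerLeft_comp_assoc]

theorem right_map_tensor {Φ Φ' Ψ Ψ' Ξ Ξ' Ω Ω' : LensCat C} (l : Φ ⟶ Ψ) (l' : Φ' ⟶ Ψ')
    (m : Ξ ⟶ Ω) (m' : Ξ' ⟶ Ω') (g : Ψ ⟶ Ξ) (c : GameContext (Φ ⊗ Φ') (Ω ⊗ Ω')) :
    (c.map (l ⊗ₘ l') (m ⊗ₘ m')).right g = (c.right (l ≫ g ≫ m)).map l' m' := by
  induction c using ind with | h Θ p k =>
  refine sound (Θ ◁ m) ?_ ?_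
  -- Once `m` has been slid into the state, the lenses on the two factors act independently and can
  -- be reordered by whisker exchange.
  · have e : (l ⊗ₘ l') ≫ g ▷ Ψ' ≫ m ▷ Ψ' = (l ≫ g ≫ m) ▷ Φ' ≫ Ω ◁ l' := by
      rw [MonoidalCategory.tensorHom_def', ← whisker_exchange]
      simp only [comp_whiskerRight, Category.assoc]
    have e' := congrArg (fun q => p ≫ Θ ◁ q ≫ (α_ Θ Ω Ψ').inv) e
    simp only [whiskerLeft_comp, Category.assoc] at e' ⊢
    rw [← associator_inv_naturality_middle, ← associator_inv_naturality_right, e']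
  · simp [MonoidalCategory.tensorHom_def]

/-- The context of the first of three players. Filling `E` and then `B` binds `E'` before `B'`,
whereas filling both at once binds `B' ⊗ E'`; the slide swaps them. -/
theorem left_left {A B E A' B' E' : LensCat C} (h : B ⟶ B') (k : E ⟶ E')
    (c : GameContext ((A ⊗ B) ⊗ E) (A' ⊗ B' ⊗ E')) :
    ((c.map (𝟙 _) (α_ A' B' E').hom).left k).left h =
      (c.map (α_ A B E).hom (𝟙 _)).left (h ⊗ₘ k) := by
  induction c using ind with | h Θ p q =>
  refine sound ((α_ Θ E' B').hom ≫ Θ ◁ (β_ E' B').hom) ?_ ?_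
  · have e := p ≫= left_left_view Θ h k (A := A)
    simpa only [Category.assoc, Category.comp_id, whiskerLeft_id] using e
  · have e := left_left_update Θ A' B' E' =≫ q
    simpa only [Category.assoc, Category.id_comp, whiskerLeft_id] using e

/-- The context of the middle player: its two neighbours may be filled in either order, at the cost
of swapping their bound outputs. -/
theorem left_right {A B E A' B' E' : LensCat C} (g : A ⟶ A') (k : E ⟶ E')
    (c : GameContext ((A ⊗ B) ⊗ E) (A' ⊗ B' ⊗ E')) :
    ((c.map (𝟙 _) (α_ A' B' E').hom).left k).right g =
      ((c.map (α_ A B E).hom (𝟙 _)).right g).left k := by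
  induction c using ind with | h Θ p q =>
  refine sound ((α_ Θ E' A').hom ≫ Θ ◁ (β_ E' A').hom ≫ (α_ Θ A' E').inv) ?_ ?_
  · have e := p ≫= left_right_view Θ g k (B := B)
    simpa only [Category.assoc, Category.comp_id, whiskerLeft_id] using e
  · have e := left_right_update Θ A' B' E' =≫ q
    simpa only [Category.assoc, Category.id_comp, whiskerLeft_id] using e

/-- The context of the last player. The bound outputs are already in the same order, so the slide
only reassociates them. -/
theorem right_right {A B E A' B' E' : LensCat C} (g : A ⟶ A') (h : B ⟶ B')
    (c : GameContext ((A ⊗ B) ⊗ E) (A' ⊗ B' ⊗ E')) :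
    (c.map (𝟙 _) (α_ A' B' E').hom).right (g ⊗ₘ h) =
      ((c.map (α_ A B E).hom (𝟙 _)).right g).right h := by
  induction c using ind with | h Θ p q =>
  refine sound (α_ Θ A' B').inv ?_ ?_
  · have e := p ≫= right_right_view Θ g h (E := E)
    simpa only [Category.assoc, Category.comp_id, whiskerLeft_id] using e
  · have e := right_right_update Θ A' B' E' =≫ q
    simpa only [Category.assoc, Category.id_comp, whiskerLeft_id] using e

/-- Filling the hole at the unit only adds a unit factor to the bound object, and `ρ_ Θ` removes it.
-/
theorem right_leftUnitor {Φ Ψ : LensCat C} (c : GameContext (𝟙_ (LensCat C) ⊗ Φ) Ψ) :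
    (c.map (𝟙 _) (λ_ Ψ).hom).right (𝟙 _) = c.map (λ_ Φ).hom (𝟙 _) := by
  induction c using ind with | h Θ p q =>
  refine sound (ρ_ Θ).hom ?_ ?_ <;> simp

theorem left_rightUnitor {Φ Ψ : LensCat C} (c : GameContext (Φ ⊗ 𝟙_ (LensCat C)) Ψ) :
    (c.map (𝟙 _) (ρ_ Ψ).hom).left (𝟙 _) = c.map (ρ_ Φ).hom (𝟙 _) := by
  induction c using ind with | h Θ p q =>
  refine sound (ρ_ Θ).hom ?_ ?_ <;> simp

/-- The bound object is `Θ ⊗ Ψ'` on both sides and the representatives themselves agree, so the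
slide is along the identity. In the continuation, the swap built into `left` cancels the one
introduced by `map`. -/
theorem left_braiding {Φ Φ' Ψ Ψ' : LensCat C} (l : Φ' ⟶ Ψ')
    (c : GameContext (Φ ⊗ Φ') (Ψ' ⊗ Ψ)) :
    (c.map (𝟙 _) (β_ Ψ Ψ').hom).left l = (c.map (β_ Φ Φ').hom (𝟙 _)).right l := by
  induction c using ind with | h Θ p q =>
  refine sound (𝟙 _) ?_ ?_
  · simp
  · rw [id_whiskerRight, Category.id_comp, ← whiskerLeft_comp_assoc Θ (β_ Ψ' Ψ).hom,
      SymmetricCategory.symmetry]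

theorem right_braiding {Φ Φ' Ψ Ψ' : LensCat C} (l : Φ ⟶ Ψ)
    (c : GameContext (Φ ⊗ Φ') (Ψ' ⊗ Ψ)) :
    (c.map (𝟙 _) (β_ Ψ Ψ').hom).right l = (c.map (β_ Φ Φ').hom (𝟙 _)).left l := by
  induction c using ind with | h Θ p q =>
  refine sound (𝟙 _) ?_ ?_
  -- On the right, the swap introduced by `map` and the one built into `left` conjugate `Φ' ◁ l`; by
  -- symmetry the result is `l ▷ Φ'`.
  · have e : l ▷ Φ' = (β_ Φ Φ').hom ≫ Φ' ◁ l ≫ (β_ Φ' Ψ).hom := by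
      rw [BraidedCategory.braiding_naturality_right, SymmetricCategory.symmetry_assoc]
    simp only [e, whiskerLeft_comp, whiskerLeft_id, id_whiskerRight, Category.assoc,
      Category.comp_id]
  · simp

end GameContext

/-! ### The axioms for open games, up to bisimulation -/

namespace OpenGame

/-- The graph of the bijection is a bisimulation; surjectivity makes its converse serial. -/
theorem Equivalent.of_equiv {Φ Ψ : LensCat C} {G H : OpenGame.{w} Φ Ψ}
    (e : G.Strategy ≃ H.Strategy) (play : ∀ σ, G.play σ = H.play (e σ))
    (br : ∀ c σ σ', σ' ∈ G.br c σ ↔ e σ' ∈ H.br c (e σ)) : Equivalent G H := by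
  refine ⟨fun σ τ => e σ = τ, ⟨fun σ => ⟨_, rfl⟩, ?_, ?_⟩,
    ⟨fun τ => ⟨e.symm τ, by simp [flip]⟩, ?_, ?_⟩⟩
  · rintro σ _ rfl
    exact play σ
  · rintro c σ σ' _ rfl h
    exact ⟨_, rfl, (br c σ σ').1 h⟩
  · rintro _ σ rfl
    exact (play σ).symm
  · rintro c _ τ' σ rfl h
    exact ⟨e.symm τ', e.apply_symm_apply τ', (br c σ _).2 (by rwa [e.apply_symm_apply])⟩

theorem comp_assoc {Φ Ψ Ξ Ω : LensCat C} (G : OpenGame.{w} Φ Ψ) (H : OpenGame.{w} Ψ Ξ)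
    (K : OpenGame.{w} Ξ Ω) : Equivalent ((G.comp H).comp K) (G.comp (H.comp K)) := by
  refine Equivalent.of_equiv (Equiv.prodAssoc _ _ _) (fun _ => Category.assoc _ _ _) ?_
  rintro c ⟨⟨σ, τ⟩, κ⟩ ⟨⟨σ', τ'⟩, κ'⟩
  change ((σ' ∈ G.br ((c.map (𝟙 Φ) (K.play κ)).map (𝟙 Φ) (H.play τ)) σ ∧
      τ' ∈ H.br ((c.map (𝟙 Φ) (K.play κ)).map (G.play σ) (𝟙 Ξ)) τ) ∧
      κ' ∈ K.br (c.map (G.play σ ≫ H.play τ) (𝟙 Ω)) κ) ↔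
    σ' ∈ G.br (c.map (𝟙 Φ) (H.play τ ≫ K.play κ)) σ ∧
      τ' ∈ H.br ((c.map (G.play σ) (𝟙 Ω)).map (𝟙 Ψ) (K.play κ)) τ ∧
      κ' ∈ K.br ((c.map (G.play σ) (𝟙 Ω)).map (H.play τ) (𝟙 Ω)) κ
  simp only [GameContext.map_map, Category.id_comp, Category.comp_id, and_assoc]

theorem single_id_comp {Φ Ψ : LensCat C} (G : OpenGame.{w} Φ Ψ) :
    Equivalent ((single (𝟙 Φ)).comp G) G := by
  refine Equivalent.of_equiv (Equiv.punitProd _) (fun _ => Category.id_comp _) ?_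
  rintro c ⟨_, σ⟩ ⟨_, σ'⟩
  change (True ∧ σ' ∈ G.br (c.map (𝟙 Φ) (𝟙 Ψ)) σ) ↔ σ' ∈ G.br c σ
  rw [GameContext.map_id, true_and]

theorem comp_single_id {Φ Ψ : LensCat C} (G : OpenGame.{w} Φ Ψ) :
    Equivalent (G.comp (single (𝟙 Ψ))) G := by
  refine Equivalent.of_equiv (Equiv.prodPUnit _) (fun _ => Category.comp_id _) ?_
  rintro c ⟨σ, _⟩ ⟨σ', _⟩
  change (σ' ∈ G.br (c.map (𝟙 Φ) (𝟙 Ψ)) σ ∧ True) ↔ σ' ∈ G.br c σ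
  rw [GameContext.map_id, and_true]

theorem single_comp_single {Φ Ψ Ξ : LensCat C} (l : Φ ⟶ Ψ) (m : Ψ ⟶ Ξ) :
    Equivalent ((single.{w} l).comp (single m)) (single (l ≫ m)) := by
  refine Equivalent.of_equiv (Equiv.prodPUnit _) (fun _ => rfl) ?_
  intro c s s'
  exact and_self_iff

theorem single_tensor_single {Φ Ψ Φ' Ψ' : LensCat C} (l : Φ ⟶ Ψ) (m : Φ' ⟶ Ψ') :
    Equivalent ((single.{w} l).tensor (single m)) (single (l ⊗ₘ m)) := by
  refine Equivalent.of_equiv (Equiv.prodPUnit _) (fun _ => rfl) ?_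
  intro c s s'
  exact and_self_iff

/-- Four players, hence four context identities; the bijection exchanges the two middle strategies.
-/
theorem tensor_comp_tensor {Φ Ψ Ξ Φ' Ψ' Ξ' : LensCat C} (G : OpenGame.{w} Φ Ψ)
    (H : OpenGame.{w} Φ' Ψ') (G' : OpenGame.{w} Ψ Ξ) (H' : OpenGame.{w} Ψ' Ξ') :
    Equivalent ((G.tensor H).comp (G'.tensor H')) ((G.comp G').tensor (H.comp H')) := by
  refine Equivalent.of_equiv (Equiv.prodProdProdComm _ _ _ _)
    (fun s => tensorHom_comp_tensorHom _ _ _ _) ?_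
  rintro c ⟨⟨σ, τ⟩, σ', τ'⟩ ⟨⟨μ, ν⟩, μ', ν'⟩
  -- For the first-stage players only the continuation is altered, by the play of the second stage;
  -- for the second-stage players only the state is altered, by the play of the first. The remaining
  -- arguments are therefore identities.
  have h₁ := GameContext.left_map_tensor (𝟙 Φ) (𝟙 Φ') (G'.play σ') (H'.play τ') (H.play τ) c
  have h₂ := GameContext.right_map_tensor (𝟙 Φ) (𝟙 Φ') (G'.play σ') (H'.play τ') (G.play σ) c
  have h₃ := GameContext.left_map_tensor (G.play σ) (H.play τ) (𝟙 Ξ) (𝟙 Ξ') (H'.play τ') c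
  have h₄ := GameContext.right_map_tensor (G.play σ) (H.play τ) (𝟙 Ξ) (𝟙 Ξ') (G'.play σ') c
  simp only [id_tensorHom_id, Category.id_comp, Category.comp_id] at h₁ h₂ h₃ h₄
  change ((μ ∈ G.br ((c.map (𝟙 _) (G'.play σ' ⊗ₘ H'.play τ')).left (H.play τ)) σ ∧
      ν ∈ H.br ((c.map (𝟙 _) (G'.play σ' ⊗ₘ H'.play τ')).right (G.play σ)) τ) ∧
      μ' ∈ G'.br ((c.map (G.play σ ⊗ₘ H.play τ) (𝟙 _)).left (H'.play τ')) σ' ∧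
      ν' ∈ H'.br ((c.map (G.play σ ⊗ₘ H.play τ) (𝟙 _)).right (G'.play σ')) τ') ↔
    (μ ∈ G.br ((c.left (H.play τ ≫ H'.play τ')).map (𝟙 Φ) (G'.play σ')) σ ∧
      μ' ∈ G'.br ((c.left (H.play τ ≫ H'.play τ')).map (G.play σ) (𝟙 Ξ)) σ') ∧
      ν ∈ H.br ((c.right (G.play σ ≫ G'.play σ')).map (𝟙 Φ') (H'.play τ')) τ ∧
      ν' ∈ H'.br ((c.right (G.play σ ≫ G'.play σ')).map (H.play τ) (𝟙 Ξ')) τ'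
  rw [h₁, h₂, h₃, h₄, and_and_and_comm]

theorem tensor_associator {A B E A' B' E' : LensCat C} (G : OpenGame.{w} A A')
    (H : OpenGame.{w} B B') (K : OpenGame.{w} E E') :
    Equivalent (((G.tensor H).tensor K).comp (single (α_ A' B' E').hom))
      ((single (α_ A B E).hom).comp (G.tensor (H.tensor K))) := by
  refine Equivalent.of_equiv ((Equiv.prodPUnit _).trans
    ((Equiv.prodAssoc _ _ _).trans (Equiv.punitProd _).symm))
    (fun s => associator_naturality _ _ _) ?_
  rintro c ⟨⟨⟨σ, τ⟩, κ⟩, _⟩ ⟨⟨⟨σ', τ'⟩, κ'⟩, _⟩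
  have h₁ := GameContext.left_left (A := A) (H.play τ) (K.play κ) c
  have h₂ := GameContext.left_right (B := B) (G.play σ) (K.play κ) c
  have h₃ := GameContext.right_right (E := E) (G.play σ) (H.play τ) c
  change (((σ' ∈ G.br (((c.map (𝟙 _) (α_ A' B' E').hom).left (K.play κ)).left (H.play τ)) σ ∧
      τ' ∈ H.br (((c.map (𝟙 _) (α_ A' B' E').hom).left (K.play κ)).right (G.play σ)) τ) ∧
      κ' ∈ K.br ((c.map (𝟙 _) (α_ A' B' E').hom).right (G.play σ ⊗ₘ H.play τ)) κ) ∧ True) ↔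
    (True ∧ σ' ∈ G.br ((c.map (α_ A B E).hom (𝟙 _)).left (H.play τ ⊗ₘ K.play κ)) σ ∧
      τ' ∈ H.br (((c.map (α_ A B E).hom (𝟙 _)).right (G.play σ)).left (K.play κ)) τ ∧
      κ' ∈ K.br (((c.map (α_ A B E).hom (𝟙 _)).right (G.play σ)).right (H.play τ)) κ)
  rw [h₁, h₂, h₃, and_true, true_and, and_assoc]

theorem tensor_leftUnitor {Φ Ψ : LensCat C} (G : OpenGame.{w} Φ Ψ) :
    Equivalent (((single (𝟙 (𝟙_ (LensCat C)))).tensor G).comp (single (λ_ Ψ).hom))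
      ((single (λ_ Φ).hom).comp G) := by
  refine Equivalent.of_equiv (Equiv.prodPUnit _)
    (fun s => (congrArg (· ≫ _) (id_tensorHom _ _)).trans (leftUnitor_naturality _)) ?_
  rintro c ⟨⟨_, σ⟩, _⟩ ⟨⟨_, σ'⟩, _⟩
  have h := GameContext.right_leftUnitor c
  -- Games given by lenses impose no best response condition, so only the context of `G` has to be
  -- compared.
  change ((True ∧ σ' ∈ G.br ((c.map (𝟙 _) (λ_ Ψ).hom).right (𝟙 _)) σ) ∧ True) ↔
    True ∧ σ' ∈ G.br (c.map (λ_ Φ).hom (𝟙 Ψ)) σ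
  rw [h, and_true]

theorem tensor_rightUnitor {Φ Ψ : LensCat C} (G : OpenGame.{w} Φ Ψ) :
    Equivalent ((G.tensor (single (𝟙 (𝟙_ (LensCat C))))).comp (single (ρ_ Ψ).hom))
      ((single (ρ_ Φ).hom).comp G) := by
  refine Equivalent.of_equiv ((Equiv.prodPUnit _).trans (Equiv.prodComm _ _))
    (fun s => (congrArg (· ≫ _) (tensorHom_id _ _)).trans (rightUnitor_naturality _)) ?_
  rintro c ⟨⟨σ, _⟩, _⟩ ⟨⟨σ', _⟩, _⟩
  have h := GameContext.left_rightUnitor c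
  change ((σ' ∈ G.br ((c.map (𝟙 _) (ρ_ Ψ).hom).left (𝟙 _)) σ ∧ True) ∧ True) ↔
    True ∧ σ' ∈ G.br (c.map (ρ_ Φ).hom (𝟙 Ψ)) σ
  rw [h, and_true, and_comm]

theorem tensor_braiding {Φ Ψ Φ' Ψ' : LensCat C} (G : OpenGame.{w} Φ Ψ) (H : OpenGame.{w} Φ' Ψ') :
    Equivalent ((G.tensor H).comp (single (β_ Ψ Ψ').hom))
      ((single (β_ Φ Φ').hom).comp (H.tensor G)) := by
  refine Equivalent.of_equiv ((Equiv.prodPUnit _).trans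
    ((Equiv.prodComm _ _).trans (Equiv.punitProd _).symm))
    (fun s => BraidedCategory.braiding_naturality _ _) ?_
  rintro c ⟨⟨σ, τ⟩, _⟩ ⟨⟨σ', τ'⟩, _⟩
  have h₁ := GameContext.left_braiding (Φ := Φ) (Ψ := Ψ) (H.play τ) c
  have h₂ := GameContext.right_braiding (Φ' := Φ') (Ψ' := Ψ') (G.play σ) c
  change ((σ' ∈ G.br ((c.map (𝟙 _) (β_ Ψ Ψ').hom).left (H.play τ)) σ ∧
      τ' ∈ H.br ((c.map (𝟙 _) (β_ Ψ Ψ').hom).right (G.play σ)) τ) ∧ True) ↔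
    True ∧ τ' ∈ H.br ((c.map (β_ Φ Φ').hom (𝟙 _)).left (G.play σ)) τ ∧
      σ' ∈ G.br ((c.map (β_ Φ Φ').hom (𝟙 _)).right (H.play τ)) σ
  rw [h₁, h₂, and_true, true_and, and_comm]

end OpenGame

end LocalContexts

/-! ### Passage to equivalence classes -/

section Classes

variable {C : Type u} [Category.{v} C] [MonoidalCategory C] [SymmetricCategory C]

namespace GameClass

theorem ind {Φ Ψ : LensCat C} {q : GameClass.{w} Φ Ψ → Prop} (h : ∀ G, q (mk G)) (c) : q c :=
  Quotient.ind h c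

theorem sound {Φ Ψ : LensCat C} {G H : OpenGame.{w} Φ Ψ} (h : OpenGame.Equivalent G H) :
    mk G = mk H :=
  Quotient.sound h

/-- The class of the open game given by a lens. -/
def ofLens {Φ Ψ : LensCat C} (l : Φ ⟶ Ψ) : GameClass.{w} Φ Ψ :=
  mk (OpenGame.single l)

/-- With `ofLens_tensor`, this transports isomorphisms and coherence diagrams from lenses to games.
-/
theorem ofLens_comp {Φ Ψ Ξ : LensCat C} (l : Φ ⟶ Ψ) (m : Ψ ⟶ Ξ) :
    (ofLens.{w} l).comp (ofLens m) = ofLens (l ≫ m) :=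
  sound (OpenGame.single_comp_single l m)

theorem ofLens_tensor {Φ Ψ Φ' Ψ' : LensCat C} (l : Φ ⟶ Ψ) (m : Φ' ⟶ Ψ') :
    (ofLens.{w} l).tensor (ofLens m) = ofLens (l ⊗ₘ m) :=
  sound (OpenGame.single_tensor_single l m)

theorem id_comp {Φ Ψ : LensCat C} (G : GameClass.{w} Φ Ψ) : (ofLens (𝟙 Φ)).comp G = G := by
  induction G using ind with | h G =>
  exact sound (OpenGame.single_id_comp G)

theorem comp_id {Φ Ψ : LensCat C} (G : GameClass.{w} Φ Ψ) : G.comp (ofLens (𝟙 Ψ)) = G := by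
  induction G using ind with | h G =>
  exact sound (OpenGame.comp_single_id G)

theorem comp_assoc {Φ Ψ Ξ Ω : LensCat C} (G : GameClass.{w} Φ Ψ) (H : GameClass.{w} Ψ Ξ)
    (K : GameClass.{w} Ξ Ω) : (G.comp H).comp K = G.comp (H.comp K) := by
  induction G using ind with | h G =>
  induction H using ind with | h H =>
  induction K using ind with | h K =>
  exact sound (OpenGame.comp_assoc G H K)

theorem tensor_comp_tensor {Φ Ψ Ξ Φ' Ψ' Ξ' : LensCat C} (G : GameClass.{w} Φ Ψ)
    (H : GameClass.{w} Φ' Ψ') (G' : GameClass.{w} Ψ Ξ) (H' : GameClass.{w} Ψ' Ξ') :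
    (G.tensor H).comp (G'.tensor H') = (G.comp G').tensor (H.comp H') := by
  induction G using ind with | h G =>
  induction H using ind with | h H =>
  induction G' using ind with | h G' =>
  induction H' using ind with | h H' =>
  exact sound (OpenGame.tensor_comp_tensor G H G' H')

theorem tensor_associator {A B E A' B' E' : LensCat C} (G : GameClass.{w} A A')
    (H : GameClass.{w} B B') (K : GameClass.{w} E E') :
    ((G.tensor H).tensor K).comp (ofLens (α_ A' B' E').hom) =
      (ofLens (α_ A B E).hom).comp (G.tensor (H.tensor K)) := by
  induction G using ind with | h G =>
  induction H using ind with | h H =>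
  induction K using ind with | h K =>
  exact sound (OpenGame.tensor_associator G H K)

theorem tensor_leftUnitor {Φ Ψ : LensCat C} (G : GameClass.{w} Φ Ψ) :
    ((ofLens (𝟙 (𝟙_ (LensCat C)))).tensor G).comp (ofLens (λ_ Ψ).hom) =
      (ofLens (λ_ Φ).hom).comp G := by
  induction G using ind with | h G =>
  exact sound (OpenGame.tensor_leftUnitor G)

theorem tensor_rightUnitor {Φ Ψ : LensCat C} (G : GameClass.{w} Φ Ψ) :
    (G.tensor (ofLens (𝟙 (𝟙_ (LensCat C))))).comp (ofLens (ρ_ Ψ).hom) =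
      (ofLens (ρ_ Φ).hom).comp G := by
  induction G using ind with | h G =>
  exact sound (OpenGame.tensor_rightUnitor G)

theorem tensor_braiding {Φ Ψ Φ' Ψ' : LensCat C} (G : GameClass.{w} Φ Ψ)
    (H : GameClass.{w} Φ' Ψ') :
    (G.tensor H).comp (ofLens (β_ Ψ Ψ').hom) = (ofLens (β_ Φ Φ').hom).comp (H.tensor G) := by
  induction G using ind with | h G =>
  induction H using ind with | h H =>
  exact sound (OpenGame.tensor_braiding G H)

end GameClass

/-! ### The symmetric monoidal category of open games -/

namespace GameCat

/-- The underlying pair of objects. -/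
abbrev toLensCat (Φ : GameCat C) : LensCat C := Φ

/-- The category of open games up to bisimulation. -/
abbrev category : Category.{max u v (w + 1)} (GameCat C) where
  Hom Φ Ψ := GameClass.{w} (C := C) Φ Ψ
  id Φ := GameClass.ofLens (𝟙 Φ.toLensCat)
  comp G H := GameClass.comp G H
  id_comp := GameClass.id_comp
  comp_id := GameClass.comp_id
  assoc := GameClass.comp_assoc

attribute [local instance] category

/-- The isomorphism of open games given by an isomorphism of lenses. -/
def isoOfLens {Φ Ψ : LensCat C} (e : Φ ≅ Ψ) :
    @Iso (GameCat C) category.{w} Φ Ψ where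
  hom := GameClass.ofLens e.hom
  inv := GameClass.ofLens e.inv
  hom_inv_id := (GameClass.ofLens_comp _ _).trans (congrArg _ e.hom_inv_id)
  inv_hom_id := (GameClass.ofLens_comp _ _).trans (congrArg _ e.inv_hom_id)

/-- Tensor, unit and structural isomorphisms of open games up to bisimulation. -/
abbrev monoidalCategoryStruct : @MonoidalCategoryStruct (GameCat C) category.{w} :=
  letI := category.{w} (C := C)
  { tensorObj := fun Φ Ψ => (Φ.toLensCat ⊗ Ψ.toLensCat : LensCat C)
    tensorHom := fun G H => GameClass.tensor G H
    whiskerLeft := fun Φ _ _ G => GameClass.tensor (GameClass.ofLens (𝟙 Φ.toLensCat)) G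
    whiskerRight := fun G Φ => GameClass.tensor G (GameClass.ofLens (𝟙 Φ.toLensCat))
    tensorUnit := 𝟙_ (LensCat C)
    associator := fun Φ Ψ Ξ => isoOfLens (α_ Φ.toLensCat Ψ.toLensCat Ξ.toLensCat)
    leftUnitor := fun Φ => isoOfLens (λ_ Φ.toLensCat)
    rightUnitor := fun Φ => isoOfLens (ρ_ Φ.toLensCat) }

attribute [local instance] monoidalCategoryStruct

open GameClass in
/-- Open games up to bisimulation form a monoidal category. -/
abbrev monoidalCategory : @MonoidalCategory (GameCat C) category.{w} :=
  letI := category.{w} (C := C)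
  MonoidalCategory.ofTensorHom
    (id_tensorHom_id := fun Φ Ψ => (ofLens_tensor _ _).trans
      (congrArg ofLens (id_tensorHom_id Φ.toLensCat Ψ.toLensCat)))
    (id_tensorHom := fun _ _ _ _ => rfl)
    (tensorHom_id := fun _ _ => rfl)
    (tensorHom_comp_tensorHom := tensor_comp_tensor)
    (associator_naturality := tensor_associator)
    (leftUnitor_naturality := tensor_leftUnitor)
    (rightUnitor_naturality := tensor_rightUnitor)
    -- Every arrow of the diagram is the class of a lens. Each side is merged into the class of one
    -- lens, and the pentagon for lenses applies; the triangle and the hexagons go the same way.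
    (pentagon := fun W X Y Z => by
      refine (congrArg₂ GameClass.comp (ofLens_tensor _ _)
        (congrArg (GameClass.comp _) (ofLens_tensor _ _))).trans ?_
      refine (congrArg (GameClass.comp _) (ofLens_comp _ _)).trans ((ofLens_comp _ _).trans
        (Eq.trans ?_ (ofLens_comp _ _).symm))
      exact congrArg ofLens
        (pentagon W.toLensCat X.toLensCat Y.toLensCat Z.toLensCat))
    (triangle := fun X Y => by
      refine (congrArg (GameClass.comp _) (ofLens_tensor _ _)).trans ((ofLens_comp _ _).trans
        (Eq.trans ?_ (ofLens_tensor _ _).symm))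
      exact congrArg ofLens (triangle X.toLensCat Y.toLensCat))

attribute [local instance] monoidalCategory

open GameClass in
/-- Open games up to bisimulation form a symmetric monoidal category. -/
abbrev symmetricCategory :
    @SymmetricCategory (GameCat C) category.{w} monoidalCategory.{w} :=
  letI := category.{w} (C := C)
  letI := monoidalCategory.{w} (C := C)
  { braiding := fun Φ Ψ => isoOfLens (β_ Φ.toLensCat Ψ.toLensCat)
    braiding_naturality_right := fun Φ _ _ G =>
      tensor_braiding (ofLens (𝟙 Φ.toLensCat)) G
    braiding_naturality_left := fun G Φ =>
      tensor_braiding G (ofLens (𝟙 Φ.toLensCat))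
    hexagon_forward := fun X Y Z => by
      refine (congrArg (GameClass.comp _) (ofLens_comp _ _)).trans ((ofLens_comp _ _).trans
        (Eq.trans ?_ ((congrArg₂ GameClass.comp (ofLens_tensor _ _)
          ((congrArg (GameClass.comp _) (ofLens_tensor _ _)).trans (ofLens_comp _ _))).trans
            (ofLens_comp _ _)).symm))
      exact congrArg ofLens
        (BraidedCategory.hexagon_forward X.toLensCat Y.toLensCat Z.toLensCat)
    hexagon_reverse := fun X Y Z => by
      refine (congrArg (GameClass.comp _) (ofLens_comp _ _)).trans ((ofLens_comp _ _).trans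
        (Eq.trans ?_ ((congrArg₂ GameClass.comp (ofLens_tensor _ _)
          ((congrArg (GameClass.comp _) (ofLens_tensor _ _)).trans (ofLens_comp _ _))).trans
            (ofLens_comp _ _)).symm))
      exact congrArg ofLens
        (BraidedCategory.hexagon_reverse X.toLensCat Y.toLensCat Z.toLensCat)
    symmetry := fun X Y => (ofLens_comp _ _).trans
      (congrArg ofLens (SymmetricCategory.symmetry X.toLensCat Y.toLensCat)) }

end GameCat

end Classes

theorem mainTheorem1 (C : Type u) [Category.{v} C] [MonoidalCategory C] [SymmetricCategory C] :
    ∃ (_ : Category.{max u v (w + 1)} (GameCat C)) (_ : MonoidalCategory (GameCat C))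
      (_ : SymmetricCategory (GameCat C)),
      SymmetricMonoidalData.ofSymmetricCategory (GameCat C) = gameData.{w} C := by
  refine ⟨GameCat.category.{w}, GameCat.monoidalCategory, GameCat.symmetricCategory, ?_⟩
  -- Only the braiding does not match by definition: in lenses its backward part is the inverse of a
  -- braiding, in `gameData` it is the opposite braiding. They agree because the braiding of `C` is
  -- symmetric.
  have h : ∀ X Y : LensCat C, (GameClass.ofLens.{w} (β_ X Y).hom) =
      GameClass.mk (OpenGame.computation (Φ := X ⊗ Y) (Ψ := Y ⊗ X) (β_ X.fst Y.fst).hom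
        (β_ Y.snd X.snd).hom) := fun X Y =>
    congrArg (fun g => GameClass.mk (OpenGame.computation (Φ := X ⊗ Y) (Ψ := Y ⊗ X) _ g))
      (SymmetricCategory.braiding_swap_eq_inv_braiding X.snd Y.snd).symm
  -- With the braiding field of `gameData` replaced along `h`, all fields agree definitionally.
  refine Eq.trans ?_ (congrArg (fun b => { gameData.{w} C with braiding := b })
    (funext fun X => funext fun Y => h X Y))
  rfl
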